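/- A lazy transposition $(a,b,p)$ on $n$ positions, with $a\neq b$ and $p\in[0,1]$, swaps the contents of positions $a$ and $b$ with probability $p$ and does nothing otherwise. For $0\le t\le n$, place $t$ distinguishable counters in positions $1,\dots,t$ and leave the other positions empty. A $(t,n)$-shuffle is a finite sequence of independent lazy transpositions which, performed one after another, leaves the counters uniformly distributed over all $t!\binom{n}{t}$ placements in the $n$ positions. Let $\tilde U_t(n)$ be the minimal length of a $(t,n)$-shuffle in which every transposition is a star transposition, i.e. of the form $(1,\cdot)$, and let $\tilde U(n)=\tilde U_n(n)$. These minima exist. Let $t=4\ell+r$ with integers $\ell\ge 0$ and $0\le r\le 3$. Then, for all $n\ge\max(t,1)$, $$\tilde U_t(n)\le\Big(\frac{7\ell}{2}+r\Big)n+O_\ell(\log n),$$ where the implied constant depends only on $\ell$. Moreover, for all $n\ge 1$, $$\tilde U(n)\le\frac78\binom n2+O(n\log n),$$ with an absolute implied constant. -/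

import Mathlib

open scoped NNReal

/-- A lazy transposition `(a, b, p)` on `n` positions: swap the contents of the two distinct
positions `a` and `b` with probability `p`, do nothing otherwise. Positions are indexed by
`Fin n`, so that the `i`-th position is the index `i - 1`. -/
structure LazyTransposition (n : ℕ) where
  /-- the first position -/
  a : Fin n
  /-- the second position -/
  b : Fin n
  a_ne_b : a ≠ b
  /-- the probability that the transposition fires -/
  p : ℝ≥0
  p_le_one : p ≤ 1

namespace LazyTransposition

/-- The law of the Boolean that says whether the transposition fires: `true` with probability
`p`, `false` with probability `1 - p`. -/
noncomputable def firingLaw {n : ℕ} (T : LazyTransposition n) : PMF Bool :=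
  PMF.ofFintype (fun fires => if fires then (T.p : ENNReal) else 1 - (T.p : ENNReal)) (by
    have h : (T.p : ENNReal) ≤ 1 := by exact_mod_cast T.p_le_one
    simpa using add_tsub_cancel_of_le h)

/-- The law of the random permutation `(a, b, p)`. -/
noncomputable def law {n : ℕ} (T : LazyTransposition n) : PMF (Equiv.Perm (Fin n)) :=
  T.firingLaw.map fun fires => if fires then Equiv.swap T.a T.b else 1

/-- A star transposition is one of the form `(1, ·)`: its first entry is the first position. -/
def IsStar {n : ℕ} (T : LazyTransposition n) : Prop :=
  (T.a : ℕ) = 0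

end LazyTransposition

/-- The law of the random permutation obtained by performing independent lazy transpositions one
after another, the head of the list first. A permutation `σ` moves the counter in position `i`
to position `σ i`; since `(σ * τ) i = σ (τ i)`, the later factor stands on the left. -/
noncomputable def compositionLaw {n : ℕ} : List (LazyTransposition n) → PMF (Equiv.Perm (Fin n))
  | [] => PMF.pure 1
  | T :: L => T.law.bind fun τ => (compositionLaw L).map fun σ => σ * τ

/-- The final positions of the `t` distinguishable counters that start in the first `t` of `n`
positions, when the contents of the positions are moved by `σ`. -/
def counterPositions {t n : ℕ} (h : t ≤ n) (σ : Equiv.Perm (Fin n)) : Fin t ↪ Fin n :=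
  (Fin.castLEEmb h).trans σ.toEmbedding

/-- A `(t, n)`-shuffle: a sequence of independent lazy transpositions after which the positions
of the `t` counters are uniform over all `t! * (n choose t)` placements, i.e. over all injections
of the counters into the positions. -/
def IsShuffle (t : ℕ) {n : ℕ} (L : List (LazyTransposition n)) : Prop :=
  ∃ h : t ≤ n, ∀ e : Fin t ↪ Fin n,
    (compositionLaw L).map (counterPositions h) e = ((t.factorial * n.choose t : ℕ) : ENNReal)⁻¹

/-- The set of lengths of `(t, n)`-shuffles all of whose transpositions are star transpositions. -/
def starShuffleLengths (t n : ℕ) : Set ℕ :=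
  {k | ∃ L : List (LazyTransposition n), (∀ T ∈ L, T.IsStar) ∧ IsShuffle t L ∧ L.length = k}

/-- `Ũ_t(n)`: the minimum length of a `(t, n)`-shuffle that uses only star transpositions. -/
noncomputable def starU (t n : ℕ) : ℕ :=
  sInf (starShuffleLengths t n)

/-! Laws of random permutations are elements of the real group algebra, with later moves on the
left. Let e_A be `symmetrizer A`. A product x of lazy transpositions of points of A spreads counters
from P ⊆ A uniformly over A as soon as x e_{A∖P} = e_A, because the contents of A∖P are irrelevant.
This is `Shuffles`. It is insensitive to relabelling, so the centres may vary: a block with its own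
centre becomes a block with the prescribed centre for one extra deterministic transposition
(`BlockProduct.exists_starProduct`). One counter among n positions then costs n, and costs of
successive groups of counters add (`Shuffles.union`).

The gain over 4n comes from treating four counters together. Their cost f satisfies f(3m) ≤ f(m) +
7m + 23 (`Shuffles.triple`), and this recursion has solution 7n/2 + O(log n). Arrange 3m positions
in three rows and m columns, with the counters in the top row. Three lazy transpositions send at
most two of them to the second row and at most one to the third. Shuffling the rows costs f(m), 2m
and m; shuffling every column completely costs 4m, three transpositions and a change of centre each.
The probability of an occupied set now depends only on the pattern of its column occupancies, a
partition of 4 into parts at most 3. The four patterns give four linear equations on the law of the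
row counts (`foldr_columnAverage_eq`), which the three firing probabilities solve once m ≥ 18
(`exists_row_probabilities`). A uniform occupied set, preceded by a random reordering of the four
counters, gives a uniform placement (`mul_symmetrizer_eq_of_uniform`).

When 3 does not divide n, each extra position costs 18 (`Shuffles.insert`). Applying this to ℓ
successive groups of four and then to r single counters gives the first bound; ℓ = ⌊n/4⌋ gives the
second. -/

set_option linter.unusedSectionVars false

/-! ### Symmetrizers: averages over the permutations of a subset. -/

section SymmetricAverages

variable {α : Type*} [Fintype α] [DecidableEq α]

/-- The real group algebra of the permutations of `α`. -/
abbrev PermAlgebra (α : Type*) := MonoidAlgebra ℝ (Equiv.Perm α)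

/-- A permutation as an element of the group algebra. -/
noncomputable abbrev permOf (σ : Equiv.Perm α) : PermAlgebra α := MonoidAlgebra.of ℝ _ σ

/-- The permutations that fix every point outside `A`. -/
def permsOn (A : Finset α) : Subgroup (Equiv.Perm α) where
  carrier := {σ | ∀ x, x ∉ A → σ x = x}
  one_mem' := fun _ _ => rfl
  mul_mem' := by
    intro σ τ hσ hτ x hx
    rw [Equiv.Perm.mul_apply, hτ x hx, hσ x hx]
  inv_mem' := by
    intro σ hσ x hx
    rw [Equiv.Perm.inv_eq_iff_eq]
    exact (hσ x hx).symm

instance (A : Finset α) : DecidablePred (· ∈ permsOn A) := fun σ =>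
  inferInstanceAs (Decidable (∀ x, x ∉ A → σ x = x))

theorem permsOn_mono {A B : Finset α} (h : A ⊆ B) : permsOn A ≤ permsOn B :=
  fun _ hσ x hx => hσ x fun hA => hx (h hA)

theorem apply_mem_of_mem_permsOn {A : Finset α} {σ : Equiv.Perm α} (hσ : σ ∈ permsOn A) {x : α} :
    σ x ∈ A ↔ x ∈ A := by
  constructor
  · intro h
    by_contra hx
    rw [hσ x hx] at h
    exact hx h
  · intro h
    by_contra hx
    have := hσ _ hx
    rw [σ.injective this] at hx
    exact hx h

theorem swap_mem_permsOn {A : Finset α} {a b : α} (ha : a ∈ A) (hb : b ∈ A) :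
    Equiv.swap a b ∈ permsOn A := fun _ hx =>
  Equiv.swap_apply_of_ne_of_ne (fun h => hx (h ▸ ha)) (fun h => hx (h ▸ hb))

/-- Any two equinumerous subsets of `A` are exchanged by a permutation supported on `A`. -/
theorem exists_perm_map_eq {A P Q : Finset α} (hP : P ⊆ A) (hQ : Q ⊆ A) (h : P.card = Q.card) :
    ∃ ρ ∈ permsOn A, ∀ x, ρ x ∈ Q ↔ x ∈ P := by
  classical
  have hcard : Fintype.card {x : {x // x ∈ A} // x.1 ∈ P}
      = Fintype.card {x : {x // x ∈ A} // x.1 ∈ Q} := by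
    have key : ∀ S : Finset α, S ⊆ A →
        Fintype.card {x : {x // x ∈ A} // x.1 ∈ S} = S.card := by
      intro S hS
      rw [← Fintype.card_coe S]
      exact Fintype.card_congr
        ⟨fun x => ⟨x.1.1, x.2⟩, fun x => ⟨⟨x.1, hS x.2⟩, x.2⟩, fun _ => rfl, fun _ => rfl⟩
    rw [key P hP, key Q hQ, h]
  let e := Fintype.equivOfCardEq hcard
  let f : Equiv.Perm {x // x ∈ A} := e.extendSubtype
  refine ⟨Equiv.Perm.ofSubtype f, fun x hx => Equiv.Perm.ofSubtype_apply_of_not_mem f hx, ?_⟩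
  intro x
  by_cases hx : x ∈ A
  · rw [Equiv.Perm.ofSubtype_apply_of_mem f hx]
    constructor
    · intro h1
      by_contra h2
      exact e.extendSubtype_not_mem ⟨x, hx⟩ h2 h1
    · intro h1
      exact e.extendSubtype_mem ⟨x, hx⟩ h1
  · rw [Equiv.Perm.ofSubtype_apply_of_not_mem f hx]
    exact ⟨fun h1 => absurd (hQ h1) hx, fun h1 => absurd (hP h1) hx⟩

/-- The average of the permutations supported on `A`. -/
noncomputable def symmetrizer (A : Finset α) : PermAlgebra α :=
  (Fintype.card (permsOn A) : ℝ)⁻¹ • ∑ σ : permsOn A, permOf σ.1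

theorem card_permsOn_ne_zero (A : Finset α) : (Fintype.card (permsOn A) : ℝ) ≠ 0 :=
  Nat.cast_ne_zero.2 Fintype.card_ne_zero

theorem permOf_mul_symmetrizer {A : Finset α} {g : Equiv.Perm α} (hg : g ∈ permsOn A) :
    permOf g * symmetrizer A = symmetrizer A := by
  rw [symmetrizer, mul_smul_comm, Finset.mul_sum]
  congr 1
  refine Fintype.sum_equiv (Equiv.mulLeft (⟨g, hg⟩ : permsOn A)) _ _ fun σ => ?_
  exact (map_mul (MonoidAlgebra.of ℝ _) g σ.1).symm

theorem symmetrizer_mul_permOf {A : Finset α} {g : Equiv.Perm α} (hg : g ∈ permsOn A) :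
    symmetrizer A * permOf g = symmetrizer A := by
  rw [symmetrizer, smul_mul_assoc, Finset.sum_mul]
  congr 1
  refine Fintype.sum_equiv (Equiv.mulRight (⟨g, hg⟩ : permsOn A)) _ _ fun σ => ?_
  exact (map_mul (MonoidAlgebra.of ℝ _) σ.1 g).symm

/-- Identities `z = symmetrizer A` are proved by evaluating `symmetrizer A * z` twice: the
symmetrizer absorbs `z`, and an invariant `z` absorbs the symmetrizer. -/
theorem symmetrizer_mul_eq {A : Finset α} {z : PermAlgebra α}
    (h : ∀ g ∈ permsOn A, permOf g * z = z) : symmetrizer A * z = z := by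
  rw [symmetrizer, smul_mul_assoc, Finset.sum_mul, Finset.sum_congr rfl fun g _ => h g.1 g.2,
    Finset.sum_const, Finset.card_univ, ← Nat.cast_smul_eq_nsmul ℝ, smul_smul,
    inv_mul_cancel₀ (card_permsOn_ne_zero A), one_smul]

theorem mul_symmetrizer_eq {A : Finset α} {z : PermAlgebra α}
    (h : ∀ g ∈ permsOn A, z * permOf g = z) : z * symmetrizer A = z := by
  rw [symmetrizer, mul_smul_comm, Finset.mul_sum, Finset.sum_congr rfl fun g _ => h g.1 g.2,
    Finset.sum_const, Finset.card_univ, ← Nat.cast_smul_eq_nsmul ℝ, smul_smul,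
    inv_mul_cancel₀ (card_permsOn_ne_zero A), one_smul]

theorem symmetrizer_mul_symmetrizer {A B : Finset α} (h : A ⊆ B) :
    symmetrizer A * symmetrizer B = symmetrizer B :=
  symmetrizer_mul_eq fun _ hg => permOf_mul_symmetrizer (permsOn_mono h hg)

theorem symmetrizer_mul_symmetrizer' {A B : Finset α} (h : A ⊆ B) :
    symmetrizer B * symmetrizer A = symmetrizer B :=
  mul_symmetrizer_eq fun _ hg => symmetrizer_mul_permOf (permsOn_mono h hg)

theorem symmetrizer_empty : symmetrizer (∅ : Finset α) = 1 := by
  rw [← mul_one (symmetrizer ∅)]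
  refine symmetrizer_mul_eq fun g hg => ?_
  have : g = 1 := Equiv.ext fun x => hg x (Finset.notMem_empty x)
  rw [this, mul_one, permOf, map_one]

/-- Conjugating a symmetrizer moves its support. -/
theorem permOf_mul_symmetrizer_comm {A B : Finset α} {ρ : Equiv.Perm α}
    (h : ∀ x, ρ x ∈ B ↔ x ∈ A) : permOf ρ * symmetrizer A = symmetrizer B * permOf ρ := by
  have key : ∀ g, g ∈ permsOn A → ρ * g * ρ⁻¹ ∈ permsOn B := by
    intro g hg x hx
    have hinv : ρ (ρ⁻¹ x) = x := ρ.apply_symm_apply x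
    have : ρ⁻¹ x ∉ A := by rwa [← h, hinv]
    simp only [Equiv.Perm.mul_apply, hg _ this, hinv]
  have key' : ∀ g, g ∈ permsOn B → ρ⁻¹ * g * ρ ∈ permsOn A := by
    intro g hg x hx
    have : ρ x ∉ B := by rwa [h]
    simp only [Equiv.Perm.mul_apply, hg _ this]
    exact ρ.symm_apply_apply x
  have h1 : symmetrizer B * (permOf ρ * symmetrizer A) = permOf ρ * symmetrizer A := by
    refine symmetrizer_mul_eq fun g hg => ?_
    have : permOf g * permOf ρ = permOf ρ * permOf (ρ⁻¹ * g * ρ) := by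
      simp only [permOf, ← map_mul]; group
    rw [← mul_assoc, this, mul_assoc, permOf_mul_symmetrizer (key' g hg)]
  have h2 : (symmetrizer B * permOf ρ) * symmetrizer A = symmetrizer B * permOf ρ := by
    refine mul_symmetrizer_eq fun g hg => ?_
    have : permOf ρ * permOf g = permOf (ρ * g * ρ⁻¹) * permOf ρ := by
      simp only [permOf, ← map_mul]; group
    rw [mul_assoc, this, ← mul_assoc, symmetrizer_mul_permOf (key g hg)]
  rw [← h1, ← mul_assoc, h2]

theorem commute_permOf_symmetrizer {A B : Finset α} (h : Disjoint A B) {g : Equiv.Perm α}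
    (hg : g ∈ permsOn A) : permOf g * symmetrizer B = symmetrizer B * permOf g := by
  refine permOf_mul_symmetrizer_comm fun x => ?_
  by_cases hx : x ∈ A
  · exact iff_of_false (Finset.disjoint_left.1 h ((apply_mem_of_mem_permsOn hg).2 hx))
      (Finset.disjoint_left.1 h hx)
  · rw [hg x hx]

/-- The decomposition of a symmetrizer into left cosets of a point stabilizer. -/
theorem symmetrizer_eq_sum_swap {A : Finset α} {o : α} (ho : o ∈ A) :
    symmetrizer A
      = ((A.card : ℝ)⁻¹ • ∑ c ∈ A, permOf (Equiv.swap o c)) * symmetrizer (A.erase o) := by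
  have hA : (A.card : ℝ) ≠ 0 := Nat.cast_ne_zero.2 (Finset.card_ne_zero_of_mem ho)
  set z := ((A.card : ℝ)⁻¹ • ∑ c ∈ A, permOf (Equiv.swap o c)) * symmetrizer (A.erase o) with hz
  have h1 : symmetrizer A * z = symmetrizer A := by
    rw [hz, ← mul_assoc, mul_smul_comm, Finset.mul_sum,
      Finset.sum_congr rfl fun c hc => symmetrizer_mul_permOf (swap_mem_permsOn ho hc),
      Finset.sum_const, ← Nat.cast_smul_eq_nsmul ℝ, smul_smul, inv_mul_cancel₀ hA, one_smul,
      symmetrizer_mul_symmetrizer' (Finset.erase_subset _ _)]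
  have h2 : symmetrizer A * z = z := by
    refine symmetrizer_mul_eq fun g hg => ?_
    rw [hz, ← mul_assoc, mul_smul_comm, Finset.mul_sum, smul_mul_assoc, smul_mul_assoc,
      Finset.sum_mul, Finset.sum_mul]
    congr 1
    -- `g` permutes the cosets: `g * swap o c` and `swap o (g c)` differ on the right by a
    -- permutation of `A.erase o`, which the symmetrizer absorbs.
    refine Finset.sum_equiv g (fun c => (apply_mem_of_mem_permsOn hg).symm) fun c hc => ?_
    have hmem : Equiv.swap o (g c) * g * Equiv.swap o c ∈ permsOn (A.erase o) := by
      intro x hx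
      by_cases hxo : x = o
      · subst hxo; simp
      · have hxA : x ∉ A := fun h => hx (Finset.mem_erase.2 ⟨hxo, h⟩)
        exact mul_mem (mul_mem (swap_mem_permsOn ho ((apply_mem_of_mem_permsOn hg).2 hc)) hg)
          (swap_mem_permsOn ho hc) x hxA
    have hsplit : permOf g * permOf (Equiv.swap o c)
        = permOf (Equiv.swap o (g c)) * permOf (Equiv.swap o (g c) * g * Equiv.swap o c) := by
      simp only [permOf, ← map_mul]
      rw [← mul_assoc, ← mul_assoc, Equiv.swap_mul_self, one_mul]
    rw [hsplit, mul_assoc, permOf_mul_symmetrizer hmem]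
  rw [← h1, h2]

end SymmetricAverages

/-! ### Products of lazy transpositions, changes of centre and the calculus of costs. -/

section LazyProducts

variable {α : Type*} [Fintype α] [DecidableEq α]

theorem symmetrizer_mul_comm_of_forall {A : Finset α} {z : PermAlgebra α}
    (h : ∀ g ∈ permsOn A, permOf g * z = z * permOf g) :
    symmetrizer A * z = z * symmetrizer A := by
  rw [symmetrizer, smul_mul_assoc, mul_smul_comm, Finset.sum_mul, Finset.mul_sum]
  exact congrArg _ (Finset.sum_congr rfl fun g _ => h g.1 g.2)

theorem symmetrizer_commute {A B : Finset α} (h : Disjoint A B) :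
    symmetrizer A * symmetrizer B = symmetrizer B * symmetrizer A :=
  symmetrizer_mul_comm_of_forall fun _ hg => commute_permOf_symmetrizer h hg

/-- The lazy transposition of `a` and `b` that fires with probability `p`. -/
noncomputable def lazySwap (a b : α) (p : ℝ) : PermAlgebra α :=
  (1 - p) • 1 + p • permOf (Equiv.swap a b)

theorem lazySwap_mul (a b : α) (p : ℝ) (z : PermAlgebra α) :
    lazySwap a b p * z = (1 - p) • z + p • (permOf (Equiv.swap a b) * z) := by
  rw [lazySwap, add_mul, smul_mul_assoc, smul_mul_assoc, one_mul]

theorem mul_lazySwap (a b : α) (p : ℝ) (z : PermAlgebra α) :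
    z * lazySwap a b p = (1 - p) • z + p • (z * permOf (Equiv.swap a b)) := by
  rw [lazySwap, mul_add, mul_smul_comm, mul_smul_comm, mul_one]

theorem lazySwap_one (a b : α) : lazySwap a b 1 = permOf (Equiv.swap a b) := by
  simp [lazySwap]

theorem permOf_mul_lazySwap (ρ : Equiv.Perm α) (a b : α) (p : ℝ) :
    permOf ρ * lazySwap a b p = lazySwap (ρ a) (ρ b) p * permOf ρ := by
  rw [mul_lazySwap, lazySwap_mul]
  congr 2
  simp only [permOf, ← map_mul]
  rw [Equiv.mul_swap_eq_swap_mul]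

/-- The products of lazy transpositions of points of `A`. -/
noncomputable def lazyProducts (A : Finset α) : Submonoid (PermAlgebra α) :=
  Submonoid.closure {x | ∃ a ∈ A, ∃ b ∈ A, ∃ p : ℝ, x = lazySwap a b p}

theorem lazySwap_mem_lazyProducts {A : Finset α} {a b : α} (ha : a ∈ A) (hb : b ∈ A) (p : ℝ) :
    lazySwap a b p ∈ lazyProducts A :=
  Submonoid.subset_closure ⟨a, ha, b, hb, p, rfl⟩

theorem lazyProducts_induction {A : Finset α} {C : PermAlgebra α → Prop} (h1 : C 1)
    (hmul : ∀ a ∈ A, ∀ b ∈ A, ∀ (p : ℝ) (x : PermAlgebra α), C x → C (lazySwap a b p * x))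
    {x : PermAlgebra α} (hx : x ∈ lazyProducts A) : C x := by
  induction hx using Submonoid.closure_induction_left with
  | one => exact h1
  | mul_left y hy z _ ih =>
    obtain ⟨a, ha, b, hb, p, rfl⟩ := hy
    exact hmul a ha b hb p z ih

theorem mul_symmetrizer_of_mem_lazyProducts {A : Finset α} {x : PermAlgebra α}
    (hx : x ∈ lazyProducts A) : x * symmetrizer A = symmetrizer A := by
  refine lazyProducts_induction (C := fun x => x * symmetrizer A = symmetrizer A) ?_ ?_ hx
  · exact one_mul _
  · intro a ha b hb p x ih
    rw [mul_assoc, ih, lazySwap_mul, permOf_mul_symmetrizer (swap_mem_permsOn ha hb), ← add_smul,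
      sub_add_cancel, one_smul]

theorem symmetrizer_mul_of_mem_lazyProducts {A : Finset α} {x : PermAlgebra α}
    (hx : x ∈ lazyProducts A) : symmetrizer A * x = symmetrizer A := by
  refine lazyProducts_induction (C := fun x => symmetrizer A * x = symmetrizer A) ?_ ?_ hx
  · exact mul_one _
  · intro a ha b hb p x ih
    rw [← mul_assoc, mul_lazySwap, symmetrizer_mul_permOf (swap_mem_permsOn ha hb), ← add_smul,
      sub_add_cancel, one_smul, ih]

theorem commute_symmetrizer_of_mem_lazyProducts {A B : Finset α} (h : Disjoint A B)
    {x : PermAlgebra α} (hx : x ∈ lazyProducts A) :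
    x * symmetrizer B = symmetrizer B * x := by
  refine lazyProducts_induction (C := fun x => x * symmetrizer B = symmetrizer B * x) ?_ ?_ hx
  · rw [one_mul, mul_one]
  · intro a ha b hb p x ih
    rw [mul_assoc, ih, ← mul_assoc, ← mul_assoc, lazySwap_mul, mul_lazySwap,
      commute_permOf_symmetrizer h (swap_mem_permsOn ha hb)]

/-- Products of at most `k` lazy transpositions of `o` with points of `A`. -/
inductive StarProduct (A : Finset α) (o : α) : ℕ → PermAlgebra α → Prop
  | one (k : ℕ) : StarProduct A o k 1
  | mul {k : ℕ} {b : α} {p : ℝ} {x : PermAlgebra α} (hb : b ∈ A) (h0 : 0 ≤ p) (h1 : p ≤ 1)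
      (hx : StarProduct A o k x) : StarProduct A o (k + 1) (lazySwap o b p * x)

theorem StarProduct.mono {A : Finset α} {o : α} {k : ℕ} {x : PermAlgebra α}
    (hx : StarProduct A o k x) {B : Finset α} (hAB : A ⊆ B) {l : ℕ} (hkl : k ≤ l) :
    StarProduct B o l x := by
  induction hx generalizing l with
  | one k => exact .one l
  | mul hb h0 h1 _ ih =>
    obtain ⟨l, rfl⟩ : ∃ l', l = l' + 1 := ⟨l - 1, by omega⟩
    exact .mul (hAB hb) h0 h1 (ih (by omega))

theorem StarProduct.mul_mul {A : Finset α} {o : α} {k l : ℕ} {x y : PermAlgebra α}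
    (hx : StarProduct A o k x) (hy : StarProduct A o l y) : StarProduct A o (k + l) (x * y) := by
  induction hx with
  | one k => rw [one_mul]; exact hy.mono subset_rfl (by omega)
  | @mul k b p x hb h0 h1 _ ih =>
    rw [mul_assoc, show k + 1 + l = k + l + 1 by omega]
    exact .mul hb h0 h1 ih

theorem StarProduct.lazySwap {A : Finset α} {o b : α} {p : ℝ} (hb : b ∈ A) (h0 : 0 ≤ p)
    (h1 : p ≤ 1) : StarProduct A o 1 (lazySwap o b p) := by
  rw [← mul_one (_root_.lazySwap o b p)]
  exact .mul hb h0 h1 (.one 0)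

theorem StarProduct.conj {A : Finset α} {o : α} {k : ℕ} {x : PermAlgebra α}
    (hx : StarProduct A o k x) {ρ : Equiv.Perm α} (hρ : ρ ∈ permsOn A) :
    StarProduct A (ρ o) k (permOf ρ * x * permOf ρ⁻¹) := by
  induction hx with
  | one k =>
    rw [mul_one, permOf, permOf, ← map_mul, mul_inv_cancel, map_one]
    exact .one k
  | mul hb h0 h1 _ ih =>
    rw [← mul_assoc, permOf_mul_lazySwap, mul_assoc, mul_assoc, ← mul_assoc (permOf ρ)]
    exact .mul ((apply_mem_of_mem_permsOn hρ).2 hb) h0 h1 ih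

theorem StarProduct.mem_lazyProducts {A : Finset α} {o : α} (ho : o ∈ A) {k : ℕ}
    {x : PermAlgebra α} (hx : StarProduct A o k x) : x ∈ lazyProducts A := by
  induction hx with
  | one k => exact one_mem _
  | mul hb _ _ _ ih => exact mul_mem (lazySwap_mem_lazyProducts ho hb _) ih

/-- Products of blocks of lazy transpositions in which every block has its own centre. The cost
is the number of lazy transpositions plus the number of blocks. -/
inductive BlockProduct (A : Finset α) : ℕ → PermAlgebra α → Prop
  | one (k : ℕ) : BlockProduct A k 1
  | mul {o : α} {j k : ℕ} {x y : PermAlgebra α} (ho : o ∈ A) (hy : StarProduct A o j y)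
      (hx : BlockProduct A k x) : BlockProduct A (k + (j + 1)) (y * x)

theorem BlockProduct.mono {A : Finset α} {k : ℕ} {x : PermAlgebra α}
    (hx : BlockProduct A k x) {B : Finset α} (hAB : A ⊆ B) {l : ℕ} (hkl : k ≤ l) :
    BlockProduct B l x := by
  induction hx generalizing l with
  | one k => exact .one l
  | @mul o j k x y ho hy _ ih =>
    have := BlockProduct.mul (hAB ho) (hy.mono hAB le_rfl) (ih (l := l - (j + 1)) (by omega))
    rwa [Nat.sub_add_cancel (by omega)] at this

theorem BlockProduct.mul_mul {A : Finset α} {k l : ℕ} {x y : PermAlgebra α}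
    (hx : BlockProduct A k x) (hy : BlockProduct A l y) : BlockProduct A (k + l) (x * y) := by
  induction hx with
  | one k => rw [one_mul]; exact hy.mono subset_rfl (by omega)
  | @mul o j k x z ho hz _ ih =>
    rw [mul_assoc, show k + (j + 1) + l = k + l + (j + 1) by omega]
    exact .mul ho hz ih

theorem StarProduct.blockProduct {A : Finset α} {o : α} (ho : o ∈ A) {k : ℕ} {x : PermAlgebra α}
    (hx : StarProduct A o k x) : BlockProduct A (k + 1) x := by
  have := BlockProduct.mul ho hx (.one 0)
  rwa [mul_one, zero_add] at this

theorem BlockProduct.mem_lazyProducts {A : Finset α} {k : ℕ}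
    {x : PermAlgebra α} (hx : BlockProduct A k x) : x ∈ lazyProducts A := by
  induction hx with
  | one k => exact one_mem _
  | mul ho hy _ ih => exact mul_mem (hy.mem_lazyProducts ho) ih

/-- Up to relabelling the positions, a product of blocks is a product of star transpositions:
changing the centre costs one deterministic transposition. -/
theorem BlockProduct.exists_starProduct {A : Finset α} {k : ℕ} {x : PermAlgebra α}
    (hx : BlockProduct A k x) {o : α} (ho : o ∈ A) {ρ : Equiv.Perm α} (hρ : ρ ∈ permsOn A) :
    ∃ ρ' ∈ permsOn A, StarProduct A o k (permOf ρ' * x * permOf ρ) := by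
  induction hx with
  | one k =>
    refine ⟨ρ⁻¹, inv_mem hρ, ?_⟩
    rw [mul_one, permOf, permOf, ← map_mul, inv_mul_cancel, map_one]
    exact .one k
  | @mul c j k x y hc hy _ ih =>
    obtain ⟨ρ', hρ', h⟩ := ih
    have hc' : ρ' c ∈ A := (apply_mem_of_mem_permsOn hρ').2 hc
    -- After the earlier relabelling the new centre sits at `ρ' c`. Firing `(o, ρ' c)` with
    -- probability one brings it to `o`; this is the extra unit charged to each block.
    set τ := Equiv.swap o (ρ' c) * ρ' with hτ
    have hτA : τ ∈ permsOn A := mul_mem (swap_mem_permsOn ho hc') hρ'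
    refine ⟨τ, hτA, ?_⟩
    have hτc : τ c = o := by simp [hτ]
    have h1 := hy.conj hτA
    rw [hτc] at h1
    have h2 : permOf τ * (y * x) * permOf ρ = (permOf τ * y * permOf τ⁻¹) *
        (lazySwap o (ρ' c) 1 * (permOf ρ' * x * permOf ρ)) := by
      have e1 : permOf τ⁻¹ * (lazySwap o (ρ' c) 1 * permOf ρ') = 1 := by
        rw [lazySwap_one, permOf, permOf, permOf, ← map_mul, ← map_mul, ← hτ, inv_mul_cancel,
          map_one]
      calc permOf τ * (y * x) * permOf ρ
          = permOf τ * y * (permOf τ⁻¹ * (lazySwap o (ρ' c) 1 * permOf ρ')) * x * permOf ρ := by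
            rw [e1, mul_one]; simp only [mul_assoc]
        _ = _ := by simp only [mul_assoc]
    rw [h2, show k + (j + 1) = j + (k + 1) by omega]
    exact h1.mul_mul (.mul hc' zero_le_one le_rfl h)

/-- `P` can be shuffled uniformly into `A` by blocks of lazy transpositions of cost `k`. -/
def Shuffles (A P : Finset α) (k : ℕ) : Prop :=
  ∃ x, BlockProduct A k x ∧ x * symmetrizer (A \ P) = symmetrizer A

theorem Shuffles.mono {A P : Finset α} {k l : ℕ} (h : Shuffles A P k) (hkl : k ≤ l) :
    Shuffles A P l := by
  obtain ⟨x, hx, hx'⟩ := h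
  exact ⟨x, hx.mono subset_rfl hkl, hx'⟩

/-- An initial relabelling carries `Q` to `P`. The relabelling left at the end is harmless, since
the uniform law on `A` is invariant. -/
theorem Shuffles.exists_starProduct {A P Q : Finset α} {k : ℕ} (h : Shuffles A P k) (hP : P ⊆ A)
    (hQ : Q ⊆ A) (hcard : Q.card = P.card) {o : α} (ho : o ∈ A) :
    ∃ x, StarProduct A o k x ∧ x * symmetrizer (A \ Q) = symmetrizer A := by
  obtain ⟨x, hx, hx'⟩ := h
  obtain ⟨ρ, hρ, hρPQ⟩ := exists_perm_map_eq hQ hP hcard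
  obtain ⟨ρ', hρ', h⟩ := hx.exists_starProduct ho hρ
  refine ⟨_, h, ?_⟩
  rw [mul_assoc, permOf_mul_symmetrizer_comm (B := A \ P), ← mul_assoc, mul_assoc (permOf ρ'), hx',
    permOf_mul_symmetrizer hρ', symmetrizer_mul_permOf hρ]
  intro a
  rw [Finset.mem_sdiff, Finset.mem_sdiff, hρPQ, apply_mem_of_mem_permsOn hρ]

/-- The extra unit arises because the star product is counted again as one block. -/
theorem Shuffles.of_card_eq {A P Q : Finset α} {k : ℕ} (h : Shuffles A P k) (hP : P ⊆ A)
    (hQ : Q ⊆ A) (hcard : Q.card = P.card) : Shuffles A Q (k + 1) := by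
  rcases A.eq_empty_or_nonempty with rfl | ⟨o, ho⟩
  · rw [Finset.subset_empty.1 hP] at h
    rw [Finset.subset_empty.1 hQ]
    exact h.mono (by omega)
  · obtain ⟨x, hx, hx'⟩ := h.exists_starProduct hP hQ hcard ho
    exact ⟨x, hx.blockProduct ho, hx'⟩

theorem Shuffles.empty (A : Finset α) : Shuffles A ∅ 0 :=
  ⟨1, .one 0, by rw [one_mul, Finset.sdiff_empty]⟩

/-- Right factors act first: `Q` is spread over `A \ P` while `P` rests. This makes the contents of
`A \ P` uniform, which is what the shuffle of `P` assumes. -/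
theorem Shuffles.union {A P Q : Finset α} {k j : ℕ} (hP : Shuffles A P k)
    (hQ : Shuffles (A \ P) Q j) : Shuffles A (P ∪ Q) (k + j) := by
  obtain ⟨x, hx, hx'⟩ := hP
  obtain ⟨y, hy, hy'⟩ := hQ
  refine ⟨x * y, hx.mul_mul (hy.mono Finset.sdiff_subset le_rfl), ?_⟩
  have : A \ (P ∪ Q) = (A \ P) \ Q := sdiff_sdiff_left.symm
  rw [this, mul_assoc, hy', hx']

theorem symmetrizer_singleton (o : α) : symmetrizer ({o} : Finset α) = 1 := by
  rw [symmetrizer_eq_sum_swap (Finset.mem_singleton_self o)]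
  simp [symmetrizer_empty]
  exact map_one (MonoidAlgebra.of ℝ (Equiv.Perm α))

/-- One counter is shuffled by star transpositions: `n - 1` of them for `n` positions. -/
theorem exists_starProduct_insert (o : α) (S : Finset α) (ho : o ∉ S) :
    ∃ x, StarProduct (insert o S) o S.card x ∧
      x * symmetrizer S = symmetrizer (insert o S) := by
  induction S using Finset.induction_on with
  | empty =>
    refine ⟨1, .one _, ?_⟩
    rw [symmetrizer_empty, insert_empty_eq, symmetrizer_singleton, one_mul]
  | insert b S hb ih =>
    have hoS : o ∉ S := fun h => ho (Finset.mem_insert_of_mem h)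
    have hob : o ≠ b := fun h => ho (h ▸ Finset.mem_insert_self _ _)
    obtain ⟨x, hx, hx'⟩ := ih hoS
    have hxmem := hx.mem_lazyProducts (Finset.mem_insert_self o S)
    set n : ℝ := ((insert o S).card : ℝ) with hn
    have hn0 : (0 : ℝ) < n := Nat.cast_pos.2 (Finset.card_pos.2 ⟨o, Finset.mem_insert_self _ _⟩)
    have hbA : b ∉ insert o S := by simp [hb, hob.symm]
    have hA' : insert o (insert b S) = insert b (insert o S) := Finset.insert_comm _ _ _
    have hcard : ((insert o (insert b S)).card : ℝ) = n + 1 := by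
      rw [hA', Finset.card_insert_of_notMem hbA, hn]; push_cast; ring
    -- The rightmost factor acts first: the counter goes to `b` with its final probability `1 / (n +
    -- 1)`. Otherwise `x`, which does not touch `b`, spreads it over the other `n` positions.
    refine ⟨x * lazySwap o b (n + 1)⁻¹, ?_, ?_⟩
    · rw [Finset.card_insert_of_notMem hb]
      refine (hx.mono ?_ le_rfl).mul_mul (.lazySwap ?_ (by positivity) ?_)
      · rw [hA']; exact Finset.subset_insert _ _
      · simp
      · exact inv_le_one_of_one_le₀ (by linarith)
    · have hswap : permOf (Equiv.swap o b) * symmetrizer (insert b S)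
          = symmetrizer (insert o S) * permOf (Equiv.swap o b) := by
        refine permOf_mul_symmetrizer_comm fun c => ?_
        by_cases hco : c = o
        · subst hco; simp [hob.symm, hb, ho]
        · by_cases hcb : c = b
          · subst hcb; simp
          · rw [Equiv.swap_apply_of_ne_of_ne hco hcb]; simp [hco, hcb]
      have h1 : x * symmetrizer (insert b S)
          = (n⁻¹ • ∑ c ∈ insert o S, permOf (Equiv.swap o c)) * symmetrizer (insert b S) := by
        rw [← symmetrizer_mul_symmetrizer (Finset.subset_insert b S), ← mul_assoc, hx',
          symmetrizer_eq_sum_swap (Finset.mem_insert_self o S), Finset.erase_insert hoS, mul_assoc,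
          ← hn]
      rw [symmetrizer_eq_sum_swap (Finset.mem_insert_self o (insert b S)), hcard,
        Finset.erase_insert ho, mul_assoc, lazySwap_mul, mul_add, mul_smul_comm, mul_smul_comm, h1,
        hswap, ← mul_assoc, mul_symmetrizer_of_mem_lazyProducts hxmem, ← hswap, hA',
        Finset.sum_insert hbA, smul_add, add_mul, smul_mul_assoc, smul_mul_assoc, smul_mul_assoc,
        smul_smul, add_comm]
      congr 2
      field_simp
      simp

theorem Shuffles.singleton {A : Finset α} {o : α} (ho : o ∈ A) : Shuffles A {o} A.card := by
  obtain ⟨x, hx, hx'⟩ := exists_starProduct_insert o (A.erase o) (Finset.notMem_erase _ _)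
  rw [Finset.insert_erase ho] at hx hx'
  have h := hx.blockProduct ho
  rw [Finset.card_erase_add_one ho] at h
  exact ⟨x, h, by rwa [Finset.sdiff_singleton_eq_erase]⟩

theorem Shuffles.of_subset {A P : Finset α} (h : P ⊆ A) : Shuffles A P (P.card * A.card) := by
  induction P using Finset.induction_on generalizing A with
  | empty => simpa using Shuffles.empty A
  | insert b P hb ih =>
    have hbA := h (Finset.mem_insert_self b P)
    have hP : P ⊆ A \ {b} := fun x hx => by
      have : x ≠ b := fun e => hb (e ▸ hx)
      simp [this, h (Finset.mem_insert_of_mem hx)]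
    rw [Finset.insert_eq]
    refine ((Shuffles.singleton hbA).union (ih hP)).mono ?_
    rw [← Finset.insert_eq, Finset.card_insert_of_notMem hb, add_mul, one_mul, add_comm]
    exact Nat.add_le_add_right (Nat.mul_le_mul_left _ (Finset.card_le_card Finset.sdiff_subset)) _

/-- One more position costs a bounded number of lazy transpositions. -/
theorem Shuffles.insert {A P : Finset α} {k : ℕ} (h : Shuffles A P k) (hP : P ⊆ A)
    (hne : P.Nonempty) {b : α} (hb : b ∉ A) :
    Shuffles (insert b A) P (k + (P.card * P.card + 2)) := by
  obtain ⟨x, hx, hx'⟩ := h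
  obtain ⟨s, hs, hs'⟩ := Shuffles.of_subset (subset_refl P)
  rw [Finset.sdiff_self, symmetrizer_empty, mul_one] at hs'
  obtain ⟨o, ho⟩ := hne
  have hbP : b ∉ P := fun h => hb (hP h)
  have hob : o ≠ b := fun h => hbP (h ▸ ho)
  have hPA' : P ⊆ Insert.insert b A := hP.trans (Finset.subset_insert _ _)
  set N : ℝ := ((Insert.insert b A).card : ℝ) with hN
  have hNpos : 0 < N := Nat.cast_pos.2 (Finset.card_pos.2 ⟨b, Finset.mem_insert_self _ _⟩)
  have hPN : (P.card : ℝ) ≤ N := Nat.cast_le.2 (Finset.card_le_card hPA')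
  -- The probability that a uniform placement occupies the new position `b`.
  set p : ℝ := P.card / N with hp
  have hp0 : 0 ≤ p := by positivity
  have hp1 : p ≤ 1 := (div_le_one hNpos).2 hPN
  set D := Insert.insert b A \ P with hD
  have hdisj : Disjoint P D := Finset.disjoint_sdiff
  set F := symmetrizer P * symmetrizer D with hF
  have hF' : F = symmetrizer D * symmetrizer P := symmetrizer_commute hdisj
  have hx1 : x * F = symmetrizer A * F := by
    have hsub : A \ P ⊆ D := Finset.sdiff_subset_sdiff (Finset.subset_insert _ _) subset_rfl
    rw [hF', ← symmetrizer_mul_symmetrizer hsub]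
    simp only [← mul_assoc]
    rw [hx', symmetrizer_mul_symmetrizer' Finset.sdiff_subset]
  have hx2 : x * (permOf (Equiv.swap o b) * F)
      = symmetrizer A * (permOf (Equiv.swap o b) * F) := by
    -- After the swap `o` is empty, so the symmetrized empty positions still contain `A \ P`, which
    -- is all that `x` needs.
    set D' := Insert.insert o (A \ P)
    have hswap : permOf (Equiv.swap o b) * symmetrizer D
        = symmetrizer D' * permOf (Equiv.swap o b) := by
      refine permOf_mul_symmetrizer_comm fun c => ?_
      by_cases hco : c = o
      · subst hco; simp [D', hD, hob.symm, hb, ho]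
      · by_cases hcb : c = b
        · subst hcb; simp [D', hD, hbP]
        · rw [Equiv.swap_apply_of_ne_of_ne hco hcb]; simp [D', hD, hco, hcb]
    have hsub : A \ P ⊆ D' := Finset.subset_insert _ _
    rw [hF', ← mul_assoc (permOf _), hswap, ← symmetrizer_mul_symmetrizer hsub]
    simp only [← mul_assoc]
    rw [hx', symmetrizer_mul_symmetrizer' Finset.sdiff_subset]
  -- `s` acts first and puts the counters in random order, so the one that may be sent from `o` to
  -- `b` is a uniformly random counter.
  refine ⟨x * lazySwap o b p * s, ?_, ?_⟩
  · rw [show k + (P.card * P.card + 2) = k + 2 + P.card * P.card by omega]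
    refine ((hx.mono (Finset.subset_insert _ _) le_rfl).mul_mul
      (StarProduct.blockProduct (hPA' ho) ?_)).mul_mul (hs.mono hPA' le_rfl)
    exact .lazySwap (Finset.mem_insert_self _ _) hp0 hp1
  · set z : PermAlgebra α := N⁻¹ • ∑ c ∈ Insert.insert b A, permOf (Equiv.swap b c) with hz
    have hcomm : symmetrizer A * z = z * symmetrizer A := by
      refine symmetrizer_mul_comm_of_forall fun g hg => ?_
      rw [hz, mul_smul_comm, smul_mul_assoc, Finset.mul_sum, Finset.sum_mul]
      congr 1
      have hg' := permsOn_mono (Finset.subset_insert b A) hg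
      refine Finset.sum_equiv g (fun c => (apply_mem_of_mem_permsOn hg').symm) fun c _ => ?_
      simp only [permOf, ← map_mul]
      rw [Equiv.mul_swap_eq_swap_mul, hg b hb]
    have hfull : symmetrizer (Insert.insert b A) = symmetrizer A * (z * F) := by
      rw [← mul_assoc, hcomm]
      have := symmetrizer_eq_sum_swap (Finset.mem_insert_self b A)
      rw [Finset.erase_insert hb, ← hN, ← hz] at this
      rw [← this, hF, ← mul_assoc, symmetrizer_mul_symmetrizer' hPA',
        symmetrizer_mul_symmetrizer' Finset.sdiff_subset]
    have hterm1 : ∀ c ∈ D, permOf (Equiv.swap b c) * F = F := by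
      intro c hc
      have hbD : b ∈ D := by simp [hD, hbP]
      rw [hF', ← mul_assoc, permOf_mul_symmetrizer (swap_mem_permsOn hbD hc)]
    -- `c` and `o` are exchanged by a permutation of `P`, absorbed by `symmetrizer A` on the left
    -- and by `F` on the right.
    have hterm2 : ∀ c ∈ P, symmetrizer A * (permOf (Equiv.swap b c) * F)
        = symmetrizer A * (permOf (Equiv.swap o b) * F) := by
      intro c hc
      have hcb : c ≠ b := fun h => hbP (h ▸ hc)
      have hconj : Equiv.swap b c = Equiv.swap o c * Equiv.swap o b * Equiv.swap o c := by
        rw [Equiv.mul_swap_eq_swap_mul (Equiv.swap o c) o b, Equiv.swap_apply_left,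
          Equiv.swap_apply_of_ne_of_ne hob.symm hcb.symm, mul_assoc, Equiv.swap_mul_self, mul_one,
          Equiv.swap_comm]
      have hoc : Equiv.swap o c ∈ permsOn P := swap_mem_permsOn ho hc
      have e1 : permOf (Equiv.swap b c)
          = permOf (Equiv.swap o c) * permOf (Equiv.swap o b) * permOf (Equiv.swap o c) := by
        rw [hconj]; simp only [permOf, map_mul]
      rw [e1]
      simp only [← mul_assoc]
      rw [symmetrizer_mul_permOf (permsOn_mono hP hoc)]
      simp only [mul_assoc]
      rw [hF, ← mul_assoc (permOf (Equiv.swap o c)), permOf_mul_symmetrizer hoc]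
    have hcardD : (D.card : ℝ) = N - P.card := by
      rw [hD, Finset.card_sdiff_of_subset hPA', Nat.cast_sub (Finset.card_le_card hPA')]
    rw [← hD, mul_assoc, hs', ← hF, mul_assoc, lazySwap_mul, mul_add, mul_smul_comm, mul_smul_comm,
      hx1, hx2, hfull, hz, smul_mul_assoc, Finset.sum_mul, mul_smul_comm, Finset.mul_sum,
      ← Finset.sum_sdiff hPA', Finset.sum_congr rfl hterm2,
      Finset.sum_congr rfl fun c hc => congrArg (symmetrizer A * ·) (hterm1 c hc)]
    simp only [Finset.sum_const, ← Nat.cast_smul_eq_nsmul ℝ, smul_add, smul_smul]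
    rw [hcardD, hp]
    congr 2
    · field_simp
    · field_simp

end LazyProducts

/-! ### Action on weights of subsets: the law of the set of occupied positions. -/

section SetAction

open scoped Pointwise

variable {α : Type*} [Fintype α] [DecidableEq α]

/-- The action of the permutations of `α` on the weights of the subsets of `α`. -/
noncomputable def setRepresentation (α : Type*) [DecidableEq α] :
    Representation ℝ (Equiv.Perm α) (Finset α → ℝ) where
  toFun g :=
    { toFun := fun w T => w (g⁻¹ • T)
      map_add' := fun _ _ => rfl
      map_smul' := fun _ _ => rfl }
  map_one' := by
    ext w T
    simp
  map_mul' g h := by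
    refine LinearMap.ext fun w => funext fun T => ?_
    change w ((g * h)⁻¹ • T) = w (h⁻¹ • (g⁻¹ • T))
    rw [mul_inv_rev, mul_smul]

/-- The action of the group algebra on the weights of the subsets of `α`. -/
noncomputable def setAction : PermAlgebra α →ₐ[ℝ] Module.End ℝ (Finset α → ℝ) :=
  (setRepresentation α).asAlgebraHom

theorem setAction_permOf (g : Equiv.Perm α) (w : Finset α → ℝ) (T : Finset α) :
    setAction (permOf g) w T = w (g⁻¹ • T) := by
  rw [setAction, permOf, Representation.asAlgebraHom_of]
  rfl

theorem setAction_mul (x y : PermAlgebra α) (w : Finset α → ℝ) :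
    setAction (x * y) w = setAction x (setAction y w) := by
  rw [map_mul]; rfl

theorem setAction_lazySwap (a b : α) (p : ℝ) (w : Finset α → ℝ) :
    setAction (lazySwap a b p) w
      = (1 - p) • w + p • setAction (permOf (Equiv.swap a b)) w := by
  rw [lazySwap, map_add, map_smul, map_smul, map_one]; rfl

theorem setAction_symmetrizer (A : Finset α) (w : Finset α → ℝ) (T : Finset α) :
    setAction (symmetrizer A) w T
      = (Fintype.card (permsOn A) : ℝ)⁻¹ * ∑ g : permsOn A, w (g.1⁻¹ • T) := by
  rw [symmetrizer, map_smul, map_sum, LinearMap.smul_apply, LinearMap.sum_apply, Pi.smul_apply,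
    Finset.sum_apply, smul_eq_mul]
  simp only [setAction_permOf]

theorem smul_finset_eq_iff {g : Equiv.Perm α} {S T : Finset α} :
    g • S = T ↔ ∀ x, g x ∈ T ↔ x ∈ S := by
  constructor
  · rintro rfl x
    exact Finset.smul_mem_smul_finset_iff g
  · intro h
    rw [smul_eq_iff_eq_inv_smul]
    ext x
    rw [Finset.mem_inv_smul_finset_iff, ← h x]
    rfl

/-- A permutation supported on `A` moves only the part of a set that lies in `A`. -/
theorem smul_union_sdiff {A : Finset α} {g : Equiv.Perm α} (hg : g ∈ permsOn A) (K T : Finset α) :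
    g • (K ∪ (T \ A)) = (g • K) ∪ (T \ A) := by
  rw [Finset.smul_finset_union]
  congr 1
  rw [smul_finset_eq_iff]
  intro x
  by_cases hx : x ∈ A
  · simp [hx, (apply_mem_of_mem_permsOn hg).2 hx]
  · rw [hg x hx]

theorem smul_subset_of_mem_permsOn {A K : Finset α} {g : Equiv.Perm α} (hg : g ∈ permsOn A)
    (hK : K ⊆ A) : g • K ⊆ A := by
  intro x hx
  rw [← inv_inv g, Finset.mem_inv_smul_finset_iff] at hx
  exact (apply_mem_of_mem_permsOn (inv_mem hg)).1 (hK hx)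

/-- The symmetrizer of `A` averages over all ways to rearrange the part of a set in `A`. -/
theorem setAction_symmetrizer_eq_sum (A : Finset α) (w : Finset α → ℝ) (T : Finset α) :
    setAction (symmetrizer A) w T = ((A.card.choose (T ∩ A).card : ℕ) : ℝ)⁻¹ *
      ∑ K ∈ Finset.powersetCard (T ∩ A).card A, w (K ∪ (T \ A)) := by
  set h := (T ∩ A).card with hh
  set v := setAction (symmetrizer A) w with hv
  have hinv : ∀ g ∈ permsOn A, ∀ U, v (g⁻¹ • U) = v U := by
    intro g hg U
    rw [← setAction_permOf g v U, hv, ← setAction_mul, permOf_mul_symmetrizer hg]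
  have hconst : ∀ K ∈ Finset.powersetCard h A, v (K ∪ (T \ A)) = v T := by
    intro K hK
    rw [Finset.mem_powersetCard] at hK
    obtain ⟨ρ, hρ, hρK⟩ := exists_perm_map_eq (Finset.inter_subset_right (s₁ := T)) hK.1
      (hh.symm.trans hK.2.symm)
    have : ρ • T = K ∪ (T \ A) := by
      conv_lhs => rw [← Finset.sdiff_union_inter T A, Finset.union_comm]
      rw [smul_union_sdiff hρ, smul_finset_eq_iff.2 hρK]
    rw [← this, ← inv_inv ρ, hinv _ (inv_mem hρ)]
  have hchoose : ((A.card.choose h : ℕ) : ℝ) ≠ 0 :=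
    Nat.cast_ne_zero.2 (Nat.choose_pos (Finset.card_le_card Finset.inter_subset_right)).ne'
  have h1 : v T = ((A.card.choose h : ℕ) : ℝ)⁻¹ *
      ∑ K ∈ Finset.powersetCard h A, v (K ∪ (T \ A)) := by
    rw [Finset.sum_congr rfl hconst, Finset.sum_const, Finset.card_powersetCard, nsmul_eq_mul,
      inv_mul_cancel_left₀ hchoose]
  rw [h1]
  congr 1
  -- A permutation of `A` only reorders the arrangements `K`, so the sum of `w` over them is
  -- unchanged by averaging over the group.
  have h2 : ∀ g ∈ permsOn A, ∑ K ∈ Finset.powersetCard h A, w (g⁻¹ • (K ∪ (T \ A)))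
      = ∑ K ∈ Finset.powersetCard h A, w (K ∪ (T \ A)) := by
    intro g hg
    have hg' := inv_mem hg
    refine Finset.sum_nbij' (fun K => g⁻¹ • K) (fun K => g • K) ?_ ?_ ?_ ?_ ?_
    · intro K hK
      rw [Finset.mem_powersetCard] at hK ⊢
      exact ⟨smul_subset_of_mem_permsOn hg' hK.1, by rw [Finset.card_smul_finset, hK.2]⟩
    · intro K hK
      rw [Finset.mem_powersetCard] at hK ⊢
      exact ⟨smul_subset_of_mem_permsOn hg hK.1, by rw [Finset.card_smul_finset, hK.2]⟩
    · intro K _; exact smul_inv_smul g K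
    · intro K _; exact inv_smul_smul g K
    · intro K _; rw [smul_union_sdiff hg']
  simp only [hv, setAction_symmetrizer]
  rw [← Finset.mul_sum, Finset.sum_comm, Finset.sum_congr rfl fun g _ => h2 g.1 g.2,
    Finset.sum_const, Finset.card_univ, nsmul_eq_mul,
    inv_mul_cancel_left₀ (card_permsOn_ne_zero A)]

/-- The unit weight at the set `S`. -/
noncomputable def pointWeight (S : Finset α) : Finset α → ℝ := fun T => if T = S then 1 else 0

theorem setAction_permOf_pointWeight (g : Equiv.Perm α) (S : Finset α) :
    setAction (permOf g) (pointWeight S) = pointWeight (g • S) := by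
  funext T
  rw [setAction_permOf, pointWeight, pointWeight]
  simp only [inv_smul_eq_iff]

theorem setAction_pointWeight_eq_zero {A P : Finset α} (hP : P ⊆ A) {x : PermAlgebra α}
    (hx : x ∈ lazyProducts A) {T : Finset α} (hT : ¬ (T ⊆ A ∧ T.card = P.card)) :
    setAction x (pointWeight P) T = 0 := by
  revert T
  refine lazyProducts_induction (C := fun x => ∀ {T : Finset α}, ¬ (T ⊆ A ∧ T.card = P.card) →
    setAction x (pointWeight P) T = 0) ?_ ?_ hx
  · intro T hT
    rw [map_one]
    refine if_neg ?_
    rintro rfl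
    exact hT ⟨hP, rfl⟩
  · intro a ha b hb p x ih T hT
    rw [setAction_mul, setAction_lazySwap, Pi.add_apply, Pi.smul_apply, Pi.smul_apply, ih hT,
      setAction_permOf, ih, smul_zero, smul_zero, add_zero]
    rintro ⟨h1, h2⟩
    refine hT ⟨?_, by rwa [Finset.card_smul_finset] at h2⟩
    have := smul_subset_of_mem_permsOn (swap_mem_permsOn ha hb) h1
    rwa [smul_inv_smul] at this

/-- The stabilizer of `P` in `permsOn A` is the product of the permutations of `P` and those of `A \
P`. -/
theorem permOf_mul_stabilizer {A P : Finset α} {g : Equiv.Perm α}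
    (hg : g ∈ permsOn A) (hgP : g • P = P) :
    permOf g * (symmetrizer P * symmetrizer (A \ P)) = symmetrizer P * symmetrizer (A \ P) := by
  rw [smul_finset_eq_iff] at hgP
  set g₁ : Equiv.Perm α := Equiv.Perm.ofSubtype (g.subtypePerm (p := (· ∈ P)) hgP) with hg₁
  have h₁ : g₁ ∈ permsOn P := fun x hx => Equiv.Perm.ofSubtype_apply_of_not_mem _ hx
  have h₁' : ∀ x ∈ P, g₁ x = g x := fun x hx => by
    rw [hg₁, Equiv.Perm.ofSubtype_apply_of_mem _ hx]; rfl
  have h₂ : g₁⁻¹ * g ∈ permsOn (A \ P) := by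
    intro x hx
    rw [Equiv.Perm.mul_apply]
    by_cases hxP : x ∈ P
    · rw [← h₁' x hxP]; exact g₁.symm_apply_apply x
    · have hxA : x ∉ A := fun h => hx (Finset.mem_sdiff.2 ⟨h, hxP⟩)
      rw [hg x hxA]
      exact (inv_mem h₁) x hxP
  have hsplit : permOf g = permOf g₁ * permOf (g₁⁻¹ * g) := by
    simp only [permOf, ← map_mul]; rw [mul_inv_cancel_left]
  rw [hsplit, mul_assoc, ← mul_assoc (permOf (g₁⁻¹ * g)),
    commute_permOf_symmetrizer Finset.sdiff_disjoint h₂, mul_assoc, permOf_mul_symmetrizer h₂,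
    ← mul_assoc, permOf_mul_symmetrizer h₁]

/-- If a product of lazy transpositions of points of `A` makes the image of the set `P` uniform,
then, after a uniform permutation of `P`, it makes the images of the points of `P` uniform. -/
theorem mul_symmetrizer_eq_of_uniform {A P : Finset α} (hP : P ⊆ A) {x : PermAlgebra α}
    (hx : x ∈ lazyProducts A) {κ : ℝ}
    (hκ : ∀ T ⊆ A, T.card = P.card → setAction x (pointWeight P) T = κ) :
    x * symmetrizer P * symmetrizer (A \ P) = symmetrizer A := by
  set v := setAction x (pointWeight P) with hv
  have hinv : ∀ g ∈ permsOn A, ∀ T, v (g⁻¹ • T) = v T := by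
    intro g hg T
    have hT' : g⁻¹ • T ⊆ A ↔ T ⊆ A := by
      refine ⟨fun h => ?_, smul_subset_of_mem_permsOn (inv_mem hg)⟩
      have := smul_subset_of_mem_permsOn hg h
      rwa [smul_inv_smul] at this
    by_cases hT : T ⊆ A ∧ T.card = P.card
    · rw [hκ T hT.1 hT.2, hκ _ (hT'.2 hT.1) (by rw [Finset.card_smul_finset, hT.2])]
    · rw [hv, setAction_pointWeight_eq_zero hP hx hT, setAction_pointWeight_eq_zero hP hx]
      rwa [hT', Finset.card_smul_finset]
  -- `ψ w` gives weight `w T` to each permutation of `A` that carries `P` to `T`. It intertwines the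
  -- action on sets with left multiplication, and sends the unit weight at `P` to the sum over the
  -- stabilizer of `P`, which acts on `F` as the scalar `N`. Hence `x * F` is determined by the law
  -- `v` of the set and inherits its invariance.
  let ψ : (Finset α → ℝ) →ₗ[ℝ] PermAlgebra α :=
    { toFun := fun w => ∑ σ : permsOn A, w (σ.1 • P) • permOf σ.1
      map_add' := fun w w' => by simp only [Pi.add_apply, add_smul, Finset.sum_add_distrib]
      map_smul' := fun c w => by
        simp only [Pi.smul_apply, smul_eq_mul, mul_smul, Finset.smul_sum, RingHom.id_apply] }
  have hψ : ∀ w, ψ w = ∑ σ : permsOn A, w (σ.1 • P) • permOf σ.1 := fun _ => rfl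
  have hψg : ∀ g ∈ permsOn A, ∀ w, permOf g * ψ w = ψ (setAction (permOf g) w) := by
    intro g hg w
    rw [hψ, hψ, Finset.mul_sum]
    refine Fintype.sum_equiv (Equiv.mulLeft (⟨g, hg⟩ : permsOn A)) _ _ fun σ => ?_
    rw [mul_smul_comm, setAction_permOf]
    simp only [Equiv.coe_mulLeft, Subgroup.coe_mul, permOf, map_mul]
    rw [mul_smul, inv_smul_smul]
  have hψx : x * ψ (pointWeight P) = ψ v := by
    rw [hv]
    refine lazyProducts_induction
      (C := fun x => x * ψ (pointWeight P) = ψ (setAction x (pointWeight P))) ?_ ?_ hx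
    · rw [one_mul, map_one]; rfl
    · intro a ha b hb p x ih
      rw [mul_assoc, ih, lazySwap_mul, hψg _ (swap_mem_permsOn ha hb), setAction_mul,
        setAction_lazySwap, map_add, map_smul, map_smul]
  set F := symmetrizer P * symmetrizer (A \ P) with hF
  set N : ℝ := ∑ σ : permsOn A, pointWeight P (σ.1 • P) with hN
  have hN0 : N ≠ 0 := by
    refine (Finset.sum_pos' (fun σ _ => ?_) ⟨1, Finset.mem_univ _, ?_⟩).ne'
    · unfold pointWeight; split_ifs <;> norm_num
    · simp [pointWeight]
  have hψF : ψ (pointWeight P) * F = N • F := by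
    rw [hψ, Finset.sum_mul, hN, Finset.sum_smul]
    refine Finset.sum_congr rfl fun σ _ => ?_
    rw [smul_mul_assoc]
    unfold pointWeight
    split_ifs with h
    · rw [permOf_mul_stabilizer σ.2 h]
    · rw [zero_smul, zero_smul]
  have hxF : x * F = N⁻¹ • (ψ v * F) := by
    rw [← hψx, mul_assoc, hψF, mul_smul_comm, smul_smul, inv_mul_cancel₀ hN0, one_smul]
  have hleft : symmetrizer A * (x * F) = x * F := by
    refine symmetrizer_mul_eq fun g hg => ?_
    rw [hxF, mul_smul_comm, ← mul_assoc, hψg g hg]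
    congr 3
    funext T
    rw [setAction_permOf, hinv g hg]
  rw [mul_assoc, ← hF, ← hleft, ← mul_assoc, symmetrizer_mul_of_mem_lazyProducts hx, hF,
    ← mul_assoc, symmetrizer_mul_symmetrizer' hP, symmetrizer_mul_symmetrizer' Finset.sdiff_subset]

/-- Shuffling `B` turns a weight that prescribes a set outside `X` into one that prescribes the
set outside `B ∪ X` and the number of points in `B`. -/
theorem setAction_symmetrizer_ite {B X S : Finset α} (hBX : Disjoint B X) {Q : Finset α → Prop}
    [DecidablePred Q] (hQ : ∀ K ⊆ B, ∀ T, Q (K ∪ (T \ B)) ↔ Q T) {c : ℝ} {w : Finset α → ℝ}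
    (hw : ∀ T, w T = if T \ X = S \ X ∧ Q T then c else 0) (T : Finset α) :
    setAction (symmetrizer B) w T = if T \ (B ∪ X) = S \ (B ∪ X) ∧ (T ∩ B).card = (S ∩ B).card ∧ Q T
      then ((B.card.choose (S ∩ B).card : ℕ) : ℝ)⁻¹ * c else 0 := by
  rw [setAction_symmetrizer_eq_sum]
  have key : ∀ K ∈ Finset.powersetCard (T ∩ B).card B, w (K ∪ (T \ B)) =
      if K = S ∩ B then (if T \ (B ∪ X) = S \ (B ∪ X) ∧ Q T then c else 0) else 0 := by
    intro K hK
    rw [Finset.mem_powersetCard] at hK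
    rw [hw]
    have : (K ∪ T \ B) \ X = S \ X ↔ K = S ∩ B ∧ T \ (B ∪ X) = S \ (B ∪ X) := by
      have hX : ∀ x ∈ B, x ∉ X := fun x hx => Finset.disjoint_left.1 hBX hx
      have hKB : ∀ x ∈ K, x ∈ B := fun x hx => hK.1 hx
      simp only [Finset.ext_iff, Finset.mem_sdiff, Finset.mem_union, Finset.mem_inter]
      constructor
      · intro h
        exact ⟨fun x => by have := h x; have := hX x; have := hKB x; tauto,
          fun x => by have := h x; have := hX x; have := hKB x; tauto⟩
      · rintro ⟨h1, h2⟩ x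
        have := h1 x; have := h2 x; have := hX x; have := hKB x; tauto
    rw [← ite_and]
    exact if_congr (by rw [this, hQ K hK.1]; tauto) rfl rfl
  rw [Finset.sum_congr rfl key, Finset.sum_ite_eq']
  by_cases hcard : (T ∩ B).card = (S ∩ B).card
  · rw [if_pos (Finset.mem_powersetCard.2 ⟨Finset.inter_subset_right, hcard.symm⟩), hcard, mul_ite,
      mul_zero]
    exact if_congr (by tauto) rfl rfl
  · rw [if_neg fun h => hcard (Finset.mem_powersetCard.1 h).2.symm, if_neg (by tauto), mul_zero]

/-- The law of a set after the three parts `A`, `B`, `C` have been shuffled. -/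
theorem setAction_symmetrizer_three {A B C S : Finset α} (hAB : Disjoint A B) (hAC : Disjoint A C)
    (hBC : Disjoint B C) (hS : S ⊆ A ∪ (B ∪ C)) {T : Finset α} (hT : T ⊆ A ∪ (B ∪ C)) :
    setAction (symmetrizer A * (symmetrizer B * symmetrizer C)) (pointWeight S) T =
      if (T ∩ A).card = (S ∩ A).card ∧ (T ∩ B).card = (S ∩ B).card ∧ (T ∩ C).card = (S ∩ C).card
      then ((A.card.choose (S ∩ A).card : ℕ) : ℝ)⁻¹ * (((B.card.choose (S ∩ B).card : ℕ) : ℝ)⁻¹ *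
        ((C.card.choose (S ∩ C).card : ℕ) : ℝ)⁻¹) else 0 := by
  have hinter : ∀ {Y Z : Finset α}, Disjoint Y Z → ∀ K ⊆ Y, ∀ T : Finset α,
      (K ∪ (T \ Y)) ∩ Z = T ∩ Z := by
    intro Y Z h K hK T
    ext x
    have := fun h1 : x ∈ Y => Finset.disjoint_left.1 h h1
    have := @hK x
    simp only [Finset.mem_inter, Finset.mem_union, Finset.mem_sdiff]
    tauto
  -- The parts are shuffled in the order `C`, `B`, `A`. The predicate `Q` accumulates the counts in
  -- the finished parts, which shuffling a disjoint part does not change.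
  have h1 := setAction_symmetrizer_ite (B := C) (X := ∅) (S := S) (Finset.disjoint_empty_right _)
    (Q := fun _ => True) (fun _ _ _ => Iff.rfl) (c := 1) (w := pointWeight S)
    (fun T => by simp [pointWeight])
  have h2 := setAction_symmetrizer_ite (B := B) (S := S)
    (Finset.disjoint_union_right.2 ⟨hBC, Finset.disjoint_empty_right _⟩)
    (fun K hK T => by rw [hinter hBC K hK T]) h1
  have h3 := setAction_symmetrizer_ite (B := A) (S := S)
    (Finset.disjoint_union_right.2 ⟨hAB, Finset.disjoint_union_right.2
      ⟨hAC, Finset.disjoint_empty_right _⟩⟩)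
    (fun K hK T => by rw [hinter hAB K hK T, hinter hAC K hK T]) h2
  rw [setAction_mul, setAction_mul, h3, Finset.union_empty, Finset.sdiff_eq_empty_iff_subset.2 hS,
    Finset.sdiff_eq_empty_iff_subset.2 hT, mul_one]
  exact if_congr (by tauto) rfl rfl

end SetAction

/-! ### Complete shuffling of columns of three positions. -/

section Columns

variable {α : Type*} [Fintype α] [DecidableEq α]

theorem symmetrizer_pair {a b : α} (hab : a ≠ b) :
    symmetrizer ({a, b} : Finset α) = lazySwap a b (1 / 2) := by
  have h1 : ({a, b} : Finset α).erase a = {b} := by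
    rw [Finset.erase_insert (by simpa using hab)]
  rw [symmetrizer_eq_sum_swap (Finset.mem_insert_self a {b}), h1, symmetrizer_singleton, mul_one,
    Finset.sum_pair hab, Finset.card_pair hab, lazySwap, Equiv.swap_self, smul_add]
  have h2 : permOf (Equiv.refl α) = 1 := map_one (MonoidAlgebra.of ℝ (Equiv.Perm α))
  rw [h2]
  norm_num

/-- Three star transpositions shuffle three positions completely. -/
theorem starProduct_symmetrizer_triple {a b c : α} (hab : a ≠ b) (hac : a ≠ c) (hbc : b ≠ c) :
    StarProduct {a, b, c} a 3 (symmetrizer ({a, b, c} : Finset α)) := by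
  -- In a uniform shuffle the content of `c` leaves with probability `2 / 3`. The left factor then
  -- sends it to `a` or `b` with equal chances, and the right factor randomizes `a`, `b` beforehand.
  have key : symmetrizer ({a, b, c} : Finset α)
      = lazySwap a b (1 / 2) * (lazySwap a c (2 / 3) * lazySwap a b (1 / 2)) := by
    have hset : ({a, b, c} : Finset α).erase c = {a, b} := by
      ext x; simp only [Finset.mem_erase, Finset.mem_insert, Finset.mem_singleton]
      constructor
      · tauto
      · rintro (rfl | rfl)
        · exact ⟨hac, .inl rfl⟩
        · exact ⟨hbc, .inr (.inl rfl)⟩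
    have hcard : ({a, b, c} : Finset α).card = 3 :=
      Finset.card_eq_three.2 ⟨a, b, c, hab, hac, hbc, rfl⟩
    have hc : c ∈ ({a, b, c} : Finset α) := by simp
    have hsum : ∑ d ∈ ({a, b, c} : Finset α), permOf (Equiv.swap c d)
        = permOf (Equiv.swap a c) + permOf (Equiv.swap b c) + 1 := by
      have h1 : permOf (Equiv.refl α) = 1 := map_one (MonoidAlgebra.of ℝ (Equiv.Perm α))
      rw [Finset.sum_insert (by simp [hab, hac]), Finset.sum_pair hbc, Equiv.swap_comm c a,
        Equiv.swap_comm c b, Equiv.swap_self, ← add_assoc, h1]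
    set e := symmetrizer ({a, b} : Finset α) with he
    have hee : e * e = e := symmetrizer_mul_symmetrizer subset_rfl
    have hmem : Equiv.swap a b ∈ permsOn ({a, b} : Finset α) := swap_mem_permsOn (by simp) (by simp)
    have hconj : permOf (Equiv.swap a b) * (permOf (Equiv.swap a c) * e)
        = permOf (Equiv.swap b c) * e := by
      have : permOf (Equiv.swap a b) * permOf (Equiv.swap a c)
          = permOf (Equiv.swap b c) * permOf (Equiv.swap a b) := by
        simp only [permOf, ← map_mul]
        rw [Equiv.mul_swap_eq_swap_mul, Equiv.swap_apply_left,
          Equiv.swap_apply_of_ne_of_ne hac.symm hbc.symm]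
      rw [← mul_assoc, this, mul_assoc, he, permOf_mul_symmetrizer hmem]
    have hpe : e * (permOf (Equiv.swap a c) * e) = (1 / 2 : ℝ) • (permOf (Equiv.swap a c) * e)
        + (1 / 2 : ℝ) • (permOf (Equiv.swap b c) * e) := by
      have he' : e = lazySwap a b (1 / 2) := symmetrizer_pair hab
      nth_rw 1 [he']
      rw [lazySwap_mul, hconj]
      norm_num
    rw [symmetrizer_eq_sum_swap hc, hcard, hset, hsum, ← symmetrizer_pair hab, ← he,
      lazySwap_mul, mul_add, mul_smul_comm, mul_smul_comm, hee, hpe, smul_mul_assoc, add_mul,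
      add_mul, one_mul]
    push_cast
    module
  rw [key]
  exact .mul (by simp) (by norm_num) (by norm_num) (.mul (by simp) (by norm_num) (by norm_num)
    (.lazySwap (by simp) (by norm_num) (by norm_num)))

/-- The average of `H` over the ways to place `h` points in a column with one point in each of
the three rows, as a function of the numbers of points placed before. -/
noncomputable def columnAverage (h : ℕ) (H : ℕ → ℕ → ℕ → ℝ) (i j k : ℕ) : ℝ :=
  match h with
  | 0 => H i j k
  | 1 => (H (i + 1) j k + H i (j + 1) k + H i j (k + 1)) / 3
  | 2 => (H (i + 1) (j + 1) k + H (i + 1) j (k + 1) + H i (j + 1) (k + 1)) / 3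
  | 3 => H (i + 1) (j + 1) (k + 1)
  | _ => 0

theorem sum_powersetCard_triple {x y z : α} (hxy : x ≠ y) (hxz : x ≠ z) (hyz : y ≠ z)
    (F : Finset α → ℝ) (h : ℕ) :
    (((3).choose h : ℕ) : ℝ)⁻¹ * ∑ K ∈ Finset.powersetCard h ({x, y, z} : Finset α), F K =
      match h with
      | 0 => F ∅
      | 1 => (F {x} + F {y} + F {z}) / 3
      | 2 => (F {x, y} + F {x, z} + F {y, z}) / 3
      | 3 => F {x, y, z}
      | _ => 0 := by
  have hx : x ∉ ({y, z} : Finset α) := by simp [hxy, hxz]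
  have hy : y ∉ ({z} : Finset α) := by simp [hyz]
  match h with
  | 0 => simp
  | 1 =>
    simp only [Finset.powersetCard_one, Finset.sum_map, Finset.sum_insert hx, Finset.sum_insert hy,
      Finset.sum_singleton, Function.Embedding.coeFn_mk]
    norm_num
    ring
  | 2 =>
    have : Finset.powersetCard 2 ({x, y, z} : Finset α) = {{x, y}, {x, z}, {y, z}} := by
      rw [Finset.powersetCard_succ_insert hx, Finset.powersetCard_succ_insert hy]
      ext K
      simp [Finset.powersetCard_one, Finset.powersetCard_eq_empty.2]
      tauto
    rw [this, Finset.sum_insert, Finset.sum_insert, Finset.sum_singleton]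
    · norm_num [Nat.choose]
      ring
    · intro hmem
      have h1 : x ∈ ({y, z} : Finset α) := (Finset.mem_singleton.1 hmem) ▸ Finset.mem_insert_self _ _
      exact hx h1
    · intro hmem
      rcases Finset.mem_insert.1 hmem with h1 | h1
      · have h2 : y ∈ ({x, z} : Finset α) := h1 ▸ (by simp)
        simp [hxy.symm, hyz] at h2
      · have h2 : x ∈ ({y, z} : Finset α) := (Finset.mem_singleton.1 h1) ▸ Finset.mem_insert_self _ _
        exact hx h2
  | 3 =>
    have hcard : ({x, y, z} : Finset α).card = 3 :=
      Finset.card_eq_three.2 ⟨x, y, z, hxy, hxz, hyz, rfl⟩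
    have : Finset.powersetCard 3 ({x, y, z} : Finset α) = {{x, y, z}} := by
      rw [← hcard, Finset.powersetCard_self]
    rw [this]
    simp
  | n + 4 =>
    rw [Nat.choose_eq_zero_of_lt (by omega)]
    simp

/-- Completely shuffling disjoint columns averages over all ways to rearrange each column. -/
theorem setAction_prod_symmetrizer_columns {ι : Type*} [DecidableEq ι] {a b c : ι → α}
    {A B C Ω : Finset α} (ha : ∀ i, a i ∈ A ∧ a i ∉ B ∧ a i ∉ C)
    (hb : ∀ i, b i ∉ A ∧ b i ∈ B ∧ b i ∉ C) (hc : ∀ i, c i ∉ A ∧ c i ∉ B ∧ c i ∈ C)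
    (hdisj : ∀ i j, i ≠ j → Disjoint ({a i, b i, c i} : Finset α) {a j, b j, c j})
    (hΩ : ∀ i, ({a i, b i, c i} : Finset α) ⊆ Ω) {w : Finset α → ℝ} {H : ℕ → ℕ → ℕ → ℝ}
    (hw : ∀ T ⊆ Ω, w T = H (T ∩ A).card (T ∩ B).card (T ∩ C).card) {l : List ι} (hl : l.Nodup)
    {T : Finset α} (hT : T ⊆ Ω) :
    setAction (l.map fun i => symmetrizer {a i, b i, c i}).prod w T =
      (l.map fun i => (T ∩ {a i, b i, c i}).card).foldr columnAverage H
        ((T \ l.toFinset.biUnion fun i => {a i, b i, c i}) ∩ A).card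
        ((T \ l.toFinset.biUnion fun i => {a i, b i, c i}) ∩ B).card
        ((T \ l.toFinset.biUnion fun i => {a i, b i, c i}) ∩ C).card := by
  induction l generalizing T with
  | nil =>
    simp only [List.map_nil, List.prod_nil, map_one, List.foldr_nil, List.toFinset_nil,
      Finset.biUnion_empty, Finset.sdiff_empty]
    exact hw T hT
  | cons i l ih =>
    obtain ⟨hil, hl'⟩ := List.nodup_cons.1 hl
    have hab : a i ≠ b i := fun h => (hb i).1 (h ▸ (ha i).1)
    have hac : a i ≠ c i := fun h => (hc i).1 (h ▸ (ha i).1)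
    have hbc : b i ≠ c i := fun h => (hc i).2.1 (h ▸ (hb i).2.1)
    have hcard : ({a i, b i, c i} : Finset α).card = 3 :=
      Finset.card_eq_three.2 ⟨_, _, _, hab, hac, hbc, rfl⟩
    set col : ι → Finset α := fun i => {a i, b i, c i} with hcol
    set U := T \ (i :: l).toFinset.biUnion col with hU
    set H' := (l.map fun j => (T ∩ col j).card).foldr columnAverage H with hH'
    -- Rearranging column `i` leaves the occupancies of the other columns alone; `K` enters only
    -- through the row counts from which the remaining average starts.
    have hK : ∀ K ∈ Finset.powersetCard (T ∩ col i).card (col i),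
        setAction (l.map fun i => symmetrizer (col i)).prod w (K ∪ (T \ col i)) =
          H' ((K ∪ U) ∩ A).card ((K ∪ U) ∩ B).card ((K ∪ U) ∩ C).card := by
      intro K hK
      have hKi := (Finset.mem_powersetCard.1 hK).1
      have hT' : K ∪ (T \ col i) ⊆ Ω :=
        Finset.union_subset (hKi.trans (hΩ i)) (Finset.sdiff_subset.trans hT)
      rw [ih hl' hT']
      have hmap : (l.map fun j => ((K ∪ (T \ col i)) ∩ col j).card)
          = l.map fun j => (T ∩ col j).card := by
        refine List.map_congr_left fun j hj => ?_
        have hij : i ≠ j := fun h => hil (h ▸ hj)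
        congr 1
        ext x
        have h1 := fun h : x ∈ col i => Finset.disjoint_left.1 (hdisj i j hij) h
        have h2 := @hKi x
        simp only [Finset.mem_inter, Finset.mem_union, Finset.mem_sdiff]
        tauto
      have hrest : (K ∪ (T \ col i)) \ l.toFinset.biUnion col = K ∪ U := by
        have h1 : Disjoint (col i) (l.toFinset.biUnion col) := by
          rw [Finset.disjoint_biUnion_right]
          intro j hj
          exact hdisj i j fun h => hil (h ▸ List.mem_toFinset.1 hj)
        rw [hU, List.toFinset_cons, Finset.biUnion_insert]
        ext x
        have h1 := fun h : x ∈ col i => Finset.disjoint_left.1 h1 h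
        have h2 := @hKi x
        simp only [Finset.mem_union, Finset.mem_sdiff]
        tauto
      rw [hmap, hrest]
    rw [List.map_cons, List.prod_cons, setAction_mul, setAction_symmetrizer_eq_sum,
      Finset.sum_congr rfl hK, hcard, sum_powersetCard_triple hab hac hbc fun K =>
        H' ((K ∪ U) ∩ A).card ((K ∪ U) ∩ B).card ((K ∪ U) ∩ C).card, List.map_cons,
      List.foldr_cons, ← hH']
    have hUi : ∀ x ∈ col i, x ∉ U := by
      intro x hx hxU
      rw [hU, List.toFinset_cons, Finset.biUnion_insert] at hxU
      exact (Finset.mem_sdiff.1 hxU).2 (Finset.mem_union_left _ hx)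
    have hUa : a i ∉ U := hUi _ (by simp [hcol])
    have hUb : b i ∉ U := hUi _ (by simp [hcol])
    have hUc : c i ∉ U := hUi _ (by simp [hcol])
    obtain ⟨ha1, ha2, ha3⟩ := ha i
    obtain ⟨hb1, hb2, hb3⟩ := hb i
    obtain ⟨hc1, hc2, hc3⟩ := hc i
    unfold columnAverage
    split <;>
    simp [Finset.insert_union, Finset.insert_inter_of_mem, Finset.insert_inter_of_notMem,
      Finset.card_insert_of_notMem, *]

end Columns

/-! ### The linear equations for the row counts and the firing probabilities that solve them. -/

section Parameters

/-- Columns in which four points are placed: all occupancies of the columns receive the same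
weight as soon as the weights of the row counts satisfy four linear equations. -/
theorem foldr_columnAverage_eq {H : ℕ → ℕ → ℕ → ℝ} {κ : ℝ} (h400 : H 4 0 0 = 3 * κ)
    (h310 : H 3 1 0 + H 3 0 1 = 6 * κ) (h220 : H 2 2 0 = 3 * κ)
    (h211 : H 2 1 1 + H 1 2 1 = 3 * κ)
    (h040 : H 0 4 0 = 0) (h004 : H 0 0 4 = 0) (h130 : H 1 3 0 = 0) (h103 : H 1 0 3 = 0)
    (h031 : H 0 3 1 = 0) (h013 : H 0 1 3 = 0) (h022 : H 0 2 2 = 0) (h202 : H 2 0 2 = 0)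
    (h112 : H 1 1 2 = 0) {l : List ℕ} (hl : ∀ h ∈ l, h ≤ 3) (hsum : l.sum = 4) :
    l.foldr columnAverage H 0 0 0 = κ := by
  -- Empty columns do not affect the average, so only compositions of 4 with parts 1, 2, 3 remain to
  -- be checked.
  have hfilter : ∀ l : List ℕ, (l.filter (· ≠ 0)).foldr columnAverage H = l.foldr columnAverage H
      ∧ (l.filter (· ≠ 0)).sum = l.sum := by
    intro l
    induction l with
    | nil => exact ⟨rfl, rfl⟩
    | cons h l ih =>
      by_cases h0 : h = 0
      · subst h0
        simp only [ne_eq, not_true_eq_false, decide_false, Bool.false_eq_true, not_false_eq_true,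
          List.filter_cons_of_neg, List.foldr_cons, List.sum_cons, zero_add]
        exact ih
      · rw [List.filter_cons_of_pos (by simpa using h0), List.foldr_cons, List.foldr_cons, ih.1,
          List.sum_cons, List.sum_cons, ih.2]
        exact ⟨rfl, rfl⟩
  have hpos : ∀ h ∈ l.filter (· ≠ 0), 1 ≤ h ∧ h ≤ 3 := by
    intro h hh
    rw [List.mem_filter] at hh
    have h1 : h ≠ 0 := by simpa using hh.2
    exact ⟨by omega, hl h hh.1⟩
  rw [← (hfilter l).1]
  rw [← (hfilter l).2] at hsum
  generalize l.filter (· ≠ 0) = r at hsum hpos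
  match r with
  | [] => simp at hsum
  | [h₁] =>
    have := hpos h₁ (by simp)
    simp at hsum
    omega
  | [h₁, h₂] =>
    have h1 := hpos h₁ (by simp)
    have h2 := hpos h₂ (by simp)
    simp at hsum
    obtain ⟨rfl, rfl⟩ | ⟨rfl, rfl⟩ | ⟨rfl, rfl⟩ :
      h₁ = 1 ∧ h₂ = 3 ∨ h₁ = 2 ∧ h₂ = 2 ∨ h₁ = 3 ∧ h₂ = 1 := by omega
    all_goals
      simp only [List.foldr, columnAverage, zero_add, Nat.reduceAdd]
      linarith
  | [h₁, h₂, h₃] =>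
    have h1 := hpos h₁ (by simp)
    have h2 := hpos h₂ (by simp)
    have h3 := hpos h₃ (by simp)
    simp at hsum
    obtain ⟨rfl, rfl, rfl⟩ | ⟨rfl, rfl, rfl⟩ | ⟨rfl, rfl, rfl⟩ :
      h₁ = 1 ∧ h₂ = 1 ∧ h₃ = 2 ∨ h₁ = 1 ∧ h₂ = 2 ∧ h₃ = 1 ∨ h₁ = 2 ∧ h₂ = 1 ∧ h₃ = 1 := by omega
    all_goals
      simp only [List.foldr, columnAverage, zero_add, Nat.reduceAdd]
      linarith
  | [h₁, h₂, h₃, h₄] =>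
    have h1 := hpos h₁ (by simp)
    have h2 := hpos h₂ (by simp)
    have h3 := hpos h₃ (by simp)
    have h4 := hpos h₄ (by simp)
    simp at hsum
    obtain ⟨rfl, rfl, rfl, rfl⟩ : h₁ = 1 ∧ h₂ = 1 ∧ h₃ = 1 ∧ h₄ = 1 := by omega
    simp only [List.foldr, columnAverage, zero_add, Nat.reduceAdd]
    linarith
  | h₁ :: h₂ :: h₃ :: h₄ :: h₅ :: _ =>
    have h1 := hpos h₁ (by simp)
    have h2 := hpos h₂ (by simp)
    have h3 := hpos h₃ (by simp)
    have h4 := hpos h₄ (by simp)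
    have h5 := hpos h₅ (by simp)
    simp at hsum
    omega

/-- Two independent events with prescribed sum and product of their probabilities. -/
theorem exists_mem_unitInterval_add_mul {u v : ℝ} (hv : 0 < v) (hu : 0 ≤ u) (hu2 : u ≤ 2)
    (h1 : 0 ≤ 1 - u + v) (hd : 4 * v ≤ u ^ 2) :
    ∃ s t : ℝ, 0 ≤ s ∧ s ≤ 1 ∧ 0 ≤ t ∧ t ≤ 1 ∧ s + t = u ∧ s * t = v := by
  -- `s` and `t` are the roots of `X² - u X + v`. Its value at 1 is nonnegative and `u ≤ 2`, so
  -- neither root exceeds 1.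
  set r := √(u ^ 2 - 4 * v) with hr
  have hr0 : 0 ≤ r := Real.sqrt_nonneg _
  have hr2 : r ^ 2 = u ^ 2 - 4 * v := Real.sq_sqrt (by linarith)
  have hru : r ≤ u := by nlinarith
  have hru' : r ≤ 2 - u := by
    by_contra! h
    nlinarith
  exact ⟨(u + r) / 2, (u - r) / 2, by linarith, by linarith, by linarith, by linarith, by ring,
    by nlinarith⟩

/-- The probabilities with which the counters are distributed over the three rows. -/
theorem exists_row_probabilities {M : ℝ} (hM : 18 ≤ M) :
    ∃ p s t : ℝ, (0 ≤ p ∧ p ≤ 1) ∧ (0 ≤ s ∧ s ≤ 1) ∧ (0 ≤ t ∧ t ≤ 1) ∧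
      (1 - p) * ((1 - s) * (1 - t)) = (M - 2) * (M - 3) / (3 * ((3 * M - 1) * (3 * M - 2))) ∧
      (1 - p) * ((1 - s) * t + s * (1 - t)) + p * ((1 - s) * (1 - t))
        = 8 * M * (M - 2) / (3 * ((3 * M - 1) * (3 * M - 2))) ∧
      (1 - p) * (s * t) = 2 * M * (M - 1) / ((3 * M - 1) * (3 * M - 2)) ∧
      p * ((1 - s) * t + s * (1 - t)) + p * (s * t)
        = 4 * M ^ 2 / ((3 * M - 1) * (3 * M - 2)) := by
  -- Below, `b`, `g`, `c`, `a` are the required probabilities of the row counts 400, 310 or 301,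
  -- 220, and 211 or 121.
  set d := (3 * M - 1) * (3 * M - 2) with hd
  have hdpos : 0 < d := mul_pos (by linarith) (by linarith)
  set a := 4 * M ^ 2 / d with ha
  set b := (M - 2) * (M - 3) / (3 * d) with hb
  set c := 2 * M * (M - 1) / d with hc
  set g := 8 * M * (M - 2) / (3 * d) with hg
  have hsum : a + b + c + g = 1 := by
    rw [ha, hb, hc, hg]
    field_simp
    rw [hd]
    ring
  have ha49 : 4 / 9 ≤ a := by
    rw [ha, div_le_div_iff₀ (by norm_num) hdpos, hd]
    nlinarith
  have hb0 : 0 ≤ b := div_nonneg (mul_nonneg (by linarith) (by linarith)) (by linarith)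
  have hc0 : 0 < c := div_pos (mul_pos (by linarith) (by linarith)) hdpos
  -- This amounts to `M² - 17 M - 6 ≥ 0`, which is where `18 ≤ M` is needed.
  have hab : a + b ≤ 1 / 2 := by
    have : a + b = (13 * M ^ 2 - 5 * M + 6) / (3 * d) := by
      rw [ha, hb]; field_simp; ring
    rw [this, div_le_div_iff₀ (by linarith) (by norm_num), hd]
    nlinarith
  have hca : c ≤ a := by
    rw [hc, ha]
    exact div_le_div_of_nonneg_right (by nlinarith) hdpos.le
  have hc4 : c ≤ 1 / 4 := by
    rw [hc, div_le_div_iff₀ hdpos (by norm_num), hd]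
    nlinarith
  -- With `e = s + t - s t` and `v = s t` the system reads `p e = a`, `(1 - p)(1 - e) = b`, `(1 - p)
  -- v = c`; the equation for `g` follows from the total being 1. Eliminating `e` leaves this
  -- quadratic, nonnegative at `2 / 5` by `a ≥ 4 / 9` and nonpositive at `1 / 2` by `a + b ≤ 1 / 2`.
  obtain ⟨p, ⟨hp1, hp2⟩, hp⟩ : ∃ p ∈ Set.Icc (2 / 5 : ℝ) (1 / 2),
      p ^ 2 - p * (1 + a - b) + a = 0 := by
    have hcont : ContinuousOn (fun p : ℝ => p ^ 2 - p * (1 + a - b) + a)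
        (Set.Icc (2 / 5 : ℝ) (1 / 2)) := by fun_prop
    have := intermediate_value_Icc' (by norm_num) hcont
    exact this ⟨by norm_num; linarith, by norm_num; linarith⟩
  have hp0 : 0 < p := by linarith
  have hq0 : 0 < 1 - p := by linarith
  set v := c / (1 - p) with hv
  set e := a / p with he
  have hvp : (1 - p) * v = c := by rw [hv]; field_simp
  have hep : p * e = a := by rw [he]; field_simp
  have hv0 : 0 < v := div_pos hc0 hq0
  have he0 : 0 < e := div_pos (by linarith) hp0
  have hve : v ≤ e := div_le_div₀ (by linarith) hca hp0 (by linarith)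
  have hv2 : v ≤ 2 * c := by
    rw [hv, div_le_iff₀ hq0]
    nlinarith
  have h1e : (1 - p) * (1 - e) = b := by
    have : p * ((1 - p) * (1 - e)) = p * b := by
      have : p * ((1 - p) * (1 - e)) = (1 - p) * (p - p * e) := by ring
      rw [this, hep]
      linarith
    exact mul_left_cancel₀ hp0.ne' this
  have he1 : e ≤ 1 := by
    by_contra! h
    nlinarith
  -- The left side is `2 c + 2 a`, and the difference of the two sides is `(1 - 2 p)(e - v)`.
  have hu0 : 4 * M / (3 * M - 2) ≤ v + e := by
    have h1 : 4 * M / (3 * M - 2) = 2 * c + 2 * a := by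
      have h2 : 2 * c + 2 * a = (12 * M ^ 2 - 4 * M) / d := by rw [hc, ha]; ring
      rw [h2, div_eq_div_iff (by linarith) hdpos.ne', hd]
      ring
    rw [h1]
    nlinarith [mul_nonneg (sub_nonneg.2 hp2) (sub_nonneg.2 hve)]
  -- The intermediate comparison is asymptotically tight: `8 c` and the square of `4 M / (3 M - 2)`
  -- both tend to `16 / 9`.
  have hdisc : 4 * v ≤ (v + e) ^ 2 := by
    have h1 : 4 * (2 * c) ≤ (4 * M / (3 * M - 2)) ^ 2 := by
      have h1 : 0 < 3 * M - 1 := by linarith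
      have h2 : 0 < 3 * M - 2 := by linarith
      rw [hc, hd, div_pow, ← mul_div_assoc, ← mul_div_assoc,
        div_le_div_iff₀ (by positivity) (by positivity)]
      have : (4 * M) ^ 2 * ((3 * M - 1) * (3 * M - 2))
            - 4 * (2 * (2 * M * (M - 1))) * (3 * M - 2) ^ 2
          = 16 * M * (3 * M - 2) * (M * (3 * M - 1) - (M - 1) * (3 * M - 2)) := by ring
      have h3 : 0 ≤ 16 * M * (3 * M - 2) * (M * (3 * M - 1) - (M - 1) * (3 * M - 2)) := by
        refine mul_nonneg (mul_nonneg (by linarith) h2.le) ?_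
        nlinarith
      linarith
    have h2 : 0 ≤ 4 * M / (3 * M - 2) := div_nonneg (by linarith) (by linarith)
    calc 4 * v ≤ 4 * (2 * c) := by linarith
      _ ≤ (4 * M / (3 * M - 2)) ^ 2 := h1
      _ ≤ (v + e) ^ 2 := pow_le_pow_left₀ h2 hu0 2
  obtain ⟨s, t, hs0, hs1, ht0, ht1, hst, hst'⟩ := exists_mem_unitInterval_add_mul hv0
    (by linarith : 0 ≤ v + e) (by linarith) (by linarith) hdisc
  have e1 : (1 - s) * (1 - t) = 1 - e := by linear_combination -hst + hst'
  have e2 : (1 - s) * t + s * (1 - t) = e - v := by linear_combination hst - 2 * hst'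
  refine ⟨p, s, t, ⟨hp0.le, by linarith⟩, ⟨hs0, hs1⟩, ⟨ht0, ht1⟩, ?_, ?_, ?_, ?_⟩
  · rw [e1, h1e]
  · rw [e1, e2]
    linarith
  · rw [hst', hvp]
  · rw [e2, hst']
    linarith

/-- The same probabilities, in the form in which the law of the row counts uses them. -/
theorem exists_row_probabilities_choose {m : ℕ} (hm : 18 ≤ m) :
    ∃ p s t κ : ℝ, (0 ≤ p ∧ p ≤ 1) ∧ (0 ≤ s ∧ s ≤ 1) ∧ (0 ≤ t ∧ t ≤ 1) ∧
      (1 - p) * ((1 - s) * (1 - t)) * ((m.choose 4 : ℕ) : ℝ)⁻¹ = 3 * κ ∧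
      ((1 - p) * ((1 - s) * t + s * (1 - t)) + p * ((1 - s) * (1 - t)))
        * (((m.choose 3 : ℕ) : ℝ)⁻¹ * (m : ℝ)⁻¹) = 6 * κ ∧
      (1 - p) * (s * t) * (((m.choose 2 : ℕ) : ℝ)⁻¹ * ((m.choose 2 : ℕ) : ℝ)⁻¹) = 3 * κ ∧
      (p * ((1 - s) * t + s * (1 - t)) + p * (s * t))
        * (((m.choose 2 : ℕ) : ℝ)⁻¹ * ((m : ℝ)⁻¹ * (m : ℝ)⁻¹)) = 3 * κ := by
  have hM : (18 : ℝ) ≤ m := by exact_mod_cast hm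
  obtain ⟨p, s, t, hp, hs, ht, h1, h2, h3, h4⟩ := exists_row_probabilities hM
  have c2 : ((m.choose 2 : ℕ) : ℝ) = m * (m - 1) / 2 := Nat.cast_choose_two ℝ m
  have c3 : ((m.choose 3 : ℕ) : ℝ) = m * (m - 1) * (m - 2) / 6 := by
    rw [Nat.cast_choose_eq_ascPochhammer_div, Nat.cast_sub (by omega)]
    simp [ascPochhammer_succ_right, Nat.factorial]
    ring
  have c4 : ((m.choose 4 : ℕ) : ℝ) = m * (m - 1) * (m - 2) * (m - 3) / 24 := by
    rw [Nat.cast_choose_eq_ascPochhammer_div, Nat.cast_sub (by omega)]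
    simp [ascPochhammer_succ_right, Nat.factorial]
    ring
  have n0 : (m : ℝ) ≠ 0 := by linarith
  have n1 : (m : ℝ) - 1 ≠ 0 := by linarith
  have n2 : (m : ℝ) - 2 ≠ 0 := by linarith
  have n3 : (m : ℝ) - 3 ≠ 0 := by linarith
  have n4 : 3 * (m : ℝ) - 1 ≠ 0 := by linarith
  have n5 : 3 * (m : ℝ) - 2 ≠ 0 := by linarith
  -- This `κ` is the inverse of the binomial coefficient of `3 m` over 4, the uniform weight.
  refine ⟨p, s, t, 8 / (3 * m * (m - 1) * ((3 * m - 1) * (3 * m - 2))), hp, hs, ht, ?_, ?_, ?_, ?_⟩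
  · rw [h1, c4]; field_simp
    norm_num
  · rw [h2, c3]; field_simp
  · rw [h3, c2]; field_simp; norm_num
  · rw [h4, c2]; field_simp; norm_num

end Parameters

/-! ### Four counters on three times as many positions. -/

section Tripling

open scoped Pointwise

variable {α : Type*} [Fintype α] [DecidableEq α]

theorem setAction_symmetrizer_pointWeight_of_disjoint {A S : Finset α} (h : Disjoint A S) :
    setAction (symmetrizer A) (pointWeight S) = pointWeight S := by
  have hfix : ∀ g ∈ permsOn A, setAction (permOf g) (pointWeight S) = pointWeight S := by
    intro g hg
    rw [setAction_permOf_pointWeight, smul_finset_eq_iff.2]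
    intro x
    by_cases hx : x ∈ A
    · exact iff_of_false (Finset.disjoint_left.1 h ((apply_mem_of_mem_permsOn hg).2 hx))
        (Finset.disjoint_left.1 h hx)
    · rw [hg x hx]
  rw [symmetrizer, map_smul, map_sum, LinearMap.smul_apply, LinearMap.sum_apply,
    Finset.sum_congr rfl fun g _ => hfix g.1 g.2, Finset.sum_const, Finset.card_univ,
    ← Nat.cast_smul_eq_nsmul ℝ, smul_smul, inv_mul_cancel₀ (card_permsOn_ne_zero A), one_smul]

/-- Shuffling the starting positions in three disjoint parts acts as the symmetrizers of these
parts on a set that meets the parts in starting positions only. -/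
theorem setAction_three_shuffles {A B C A' B' C' S : Finset α} (hAB : Disjoint A B)
    (hAC : Disjoint A C) (hBC : Disjoint B C) (hA' : A' ⊆ A) (hB' : B' ⊆ B)
    {x y z : PermAlgebra α} (hy : y ∈ lazyProducts B) (hz : z ∈ lazyProducts C)
    (hx' : x * symmetrizer A' = symmetrizer A) (hy' : y * symmetrizer B' = symmetrizer B)
    (hz' : z * symmetrizer C' = symmetrizer C) (hSA : Disjoint A' S) (hSB : Disjoint B' S)
    (hSC : Disjoint C' S) :
    setAction (x * (y * z)) (pointWeight S)
      = setAction (symmetrizer A * (symmetrizer B * symmetrizer C)) (pointWeight S) := by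
  -- These symmetrizers move only empty positions, so they can be inserted freely; they supply the
  -- factors that `hx'`, `hy'`, `hz'` require.
  have hfix : pointWeight S
      = setAction (symmetrizer A' * (symmetrizer B' * symmetrizer C')) (pointWeight S) := by
    rw [setAction_mul, setAction_mul, setAction_symmetrizer_pointWeight_of_disjoint hSC,
      setAction_symmetrizer_pointWeight_of_disjoint hSB,
      setAction_symmetrizer_pointWeight_of_disjoint hSA]
  conv_lhs => rw [hfix]
  rw [← setAction_mul]
  refine congrArg (fun u => setAction u (pointWeight S)) ?_
  have h1 : z * symmetrizer A' = symmetrizer A' * z :=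
    commute_symmetrizer_of_mem_lazyProducts (hAC.symm.mono_right hA') hz
  have h2 : y * symmetrizer A' = symmetrizer A' * y :=
    commute_symmetrizer_of_mem_lazyProducts (hAB.symm.mono_right hA') hy
  have h3 : z * symmetrizer B' = symmetrizer B' * z :=
    commute_symmetrizer_of_mem_lazyProducts (hBC.symm.mono_right hB') hz
  calc x * (y * z) * (symmetrizer A' * (symmetrizer B' * symmetrizer C'))
      = x * (y * (z * symmetrizer A') * (symmetrizer B' * symmetrizer C')) := by
        simp only [mul_assoc]
    _ = x * (y * symmetrizer A') * (z * symmetrizer B') * symmetrizer C' := by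
        rw [h1]; simp only [mul_assoc]
    _ = (x * symmetrizer A') * (y * symmetrizer B') * (z * symmetrizer C') := by
        rw [h2, h3]; simp only [mul_assoc]
    _ = _ := by rw [hx', hy', hz', mul_assoc]

/-- A lazy transposition moves a counter to an empty position with the given probability. -/
theorem setAction_lazySwap_pointWeight {a b : α} {S : Finset α} (ha : a ∉ S) (hb : b ∉ S) (p : ℝ) :
    setAction (lazySwap a b p) (pointWeight (insert a S))
      = (1 - p) • pointWeight (insert a S) + p • pointWeight (insert b S) := by
  rw [setAction_lazySwap, setAction_permOf_pointWeight]
  congr 3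
  rw [smul_finset_eq_iff]
  intro x
  by_cases hxa : x = a
  · subst hxa; simp
  · by_cases hxb : x = b
    · subst hxb
      simp only [Equiv.swap_apply_right, Finset.mem_insert, hb, ha, or_false, hxa, iff_false]
      exact fun h => hxa h.symm
    · rw [Equiv.swap_apply_of_ne_of_ne hxa hxb]
      simp [hxa, hxb]

theorem BlockProduct.list_prod {ι : Type*} {A : Finset α} {y : ι → PermAlgebra α} {k : ℕ}
    (hy : ∀ i, BlockProduct A k (y i)) (l : List ι) :
    BlockProduct A (l.length * k) (l.map y).prod := by
  induction l with
  | nil => exact .one _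
  | cons i l ih =>
    rw [List.map_cons, List.prod_cons, List.length_cons, add_mul, one_mul, add_comm]
    exact (hy i).mul_mul ih

/-- The law of the row counts after three lazy moves of counters to the second and third row. -/
noncomputable def rowCountLaw (m : ℕ) (p s t : ℝ) (i j k : ℕ) : ℝ :=
  let q : ℕ → ℕ → ℕ → ℝ := fun i' j' k' => if i = i' ∧ j = j' ∧ k = k' then
    ((m.choose i' : ℕ) : ℝ)⁻¹ * (((m.choose j' : ℕ) : ℝ)⁻¹ * ((m.choose k' : ℕ) : ℝ)⁻¹) else 0
  (1 - p) * ((1 - s) * ((1 - t) * q 4 0 0 + t * q 3 1 0)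
      + s * ((1 - t) * q 3 1 0 + t * q 2 2 0))
    + p * ((1 - s) * ((1 - t) * q 3 0 1 + t * q 2 1 1)
      + s * ((1 - t) * q 2 1 1 + t * q 1 2 1))

/-- The counts 310 and 301 carry the same binomial factors, and so do 211 and 121. Hence only the
sums of their probabilities are constrained. -/
theorem foldr_columnAverage_rowCountLaw {m : ℕ} {p s t κ : ℝ}
    (h1 : (1 - p) * ((1 - s) * (1 - t)) * ((m.choose 4 : ℕ) : ℝ)⁻¹ = 3 * κ)
    (h2 : ((1 - p) * ((1 - s) * t + s * (1 - t)) + p * ((1 - s) * (1 - t)))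
        * (((m.choose 3 : ℕ) : ℝ)⁻¹ * (m : ℝ)⁻¹) = 6 * κ)
    (h3 : (1 - p) * (s * t) * (((m.choose 2 : ℕ) : ℝ)⁻¹ * ((m.choose 2 : ℕ) : ℝ)⁻¹) = 3 * κ)
    (h4 : (p * ((1 - s) * t + s * (1 - t)) + p * (s * t))
        * (((m.choose 2 : ℕ) : ℝ)⁻¹ * ((m : ℝ)⁻¹ * (m : ℝ)⁻¹)) = 3 * κ)
    {l : List ℕ} (hl : ∀ h ∈ l, h ≤ 3) (hsum : l.sum = 4) :
    l.foldr columnAverage (rowCountLaw m p s t) 0 0 0 = κ := by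
  refine foldr_columnAverage_eq ?_ ?_ ?_ ?_ ?_ ?_ ?_ ?_ ?_ ?_ ?_ ?_ ?_ hl hsum <;>
    simp only [rowCountLaw, Nat.choose_zero_right, Nat.choose_one_right, Nat.reduceEqDiff,
      OfNat.ofNat_ne_zero, OfNat.zero_ne_ofNat, OfNat.ofNat_ne_one, OfNat.one_ne_ofNat, one_ne_zero,
      zero_ne_one, and_self, and_true, and_false, if_true, if_false, Nat.cast_one,
      inv_one, mul_one, mul_zero, add_zero, zero_add]
  · linarith
  · rw [← h2]; ring
  · linarith
  · rw [← h4]; ring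

/-- Tripling the number of positions: the three thirds are shuffled with at most four, two and one
counters, and then the columns with one position in each third are shuffled. -/
theorem Shuffles.triple {Ω P : Finset α} {m k : ℕ} (hm : 18 ≤ m) (hΩ : Ω.card = 3 * m)
    (hk : ∀ A Q : Finset α, A.card = m → Q ⊆ A → Q.card = 4 → Shuffles A Q k)
    (hP : P ⊆ Ω) (hP4 : P.card = 4) : Shuffles Ω P (k + 7 * m + 23) := by
  obtain ⟨p, s, t, κ, ⟨hp0, hp1⟩, ⟨hs0, hs1⟩, ⟨ht0, ht1⟩, hκ1, hκ2, hκ3, hκ4⟩ :=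
    exists_row_probabilities_choose hm
  have hcardΩ : Fintype.card (Fin m × Fin 3) = Fintype.card {x // x ∈ Ω} := by
    simp [hΩ, mul_comm]
  let e := Fintype.equivOfCardEq hcardΩ
  obtain ⟨f, hfe⟩ : ∃ f : Fin m → Fin 3 → α, ∀ i r, f i r = (e (i, r)).1 :=
    ⟨fun i r => (e (i, r)).1, fun _ _ => rfl⟩
  have hf : ∀ i r j r', f i r = f j r' ↔ i = j ∧ r = r' := by
    intro i r j r'
    rw [hfe, hfe, Subtype.coe_inj, e.injective.eq_iff, Prod.mk_inj]
  have hfΩ : ∀ i r, f i r ∈ Ω := fun i r => by rw [hfe]; exact (e (i, r)).2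
  have hΩf : ∀ x ∈ Ω, ∃ i r, f i r = x := by
    intro x hx
    obtain ⟨⟨i, r⟩, h⟩ := e.surjective ⟨x, hx⟩
    exact ⟨i, r, by rw [hfe, h]⟩
  obtain ⟨row, hrow⟩ : ∃ row : Fin 3 → Finset α, ∀ r, row r = Finset.univ.image fun i => f i r :=
    ⟨fun r => Finset.univ.image fun i => f i r, fun _ => rfl⟩
  have hmem : ∀ i r r', f i r ∈ row r' ↔ r' = r := by
    intro i r r'
    simp [hrow, hf]
  have hrowcard : ∀ r, (row r).card = m := by
    intro r
    rw [hrow, Finset.card_image_of_injective _ fun i j h => ((hf _ _ _ _).1 h).1,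
      Finset.card_univ, Fintype.card_fin]
  have hrowΩ : ∀ r, row r ⊆ Ω := by
    intro r x hx
    rw [hrow] at hx
    obtain ⟨i, _, rfl⟩ := Finset.mem_image.1 hx
    exact hfΩ i r
  have hrowdisj : ∀ r r', r ≠ r' → Disjoint (row r) (row r') := by
    intro r r' h
    rw [Finset.disjoint_left]
    intro x hx
    rw [hrow] at hx
    obtain ⟨i, _, rfl⟩ := Finset.mem_image.1 hx
    rw [hmem]
    exact fun h' => h h'.symm
  have h01 := hrowdisj 0 1 (by decide)
  have h02 := hrowdisj 0 2 (by decide)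
  have h12 := hrowdisj 1 2 (by decide)
  have hΩrow : Ω = row 0 ∪ (row 1 ∪ row 2) := by
    refine subset_antisymm (fun x hx => ?_) (Finset.union_subset (hrowΩ 0)
      (Finset.union_subset (hrowΩ 1) (hrowΩ 2)))
    obtain ⟨i, r, rfl⟩ := hΩf x hx
    simp only [Finset.mem_union, hmem]
    fin_cases r <;> simp
  obtain ⟨i₀, i₁, i₂, i₃, n01, n02, n03, n12, n13, n23⟩ : ∃ i₀ i₁ i₂ i₃ : Fin m,
      i₀ ≠ i₁ ∧ i₀ ≠ i₂ ∧ i₀ ≠ i₃ ∧ i₁ ≠ i₂ ∧ i₁ ≠ i₃ ∧ i₂ ≠ i₃ := by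
    refine ⟨⟨0, by omega⟩, ⟨1, by omega⟩, ⟨2, by omega⟩, ⟨3, by omega⟩, ?_, ?_, ?_, ?_, ?_, ?_⟩ <;>
      simp
  let S : α → α → α → Finset α := fun u v w => {u, v, w, f i₀ 0}
  have hS : ∀ u v w, S u v w = {u, v, w, f i₀ 0} := fun _ _ _ => rfl
  -- `f i r` is the position in column `i` and row `r`. The counters start in `P₀`; `P₁` and `P₂`
  -- are the places in the other rows that `prep` can reach.
  set P₀ : Finset α := {f i₃ 0, f i₂ 0, f i₁ 0, f i₀ 0} with hP₀
  set P₁ : Finset α := {f i₀ 1, f i₁ 1} with hP₁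
  set P₂ : Finset α := {f i₀ 2} with hP₂
  have hP₀row : P₀ ⊆ row 0 := by
    intro x hx
    simp only [hP₀, Finset.mem_insert, Finset.mem_singleton] at hx
    rcases hx with rfl | rfl | rfl | rfl <;> rw [hmem]
  have hP₁row : P₁ ⊆ row 1 := by
    intro x hx
    simp only [hP₁, Finset.mem_insert, Finset.mem_singleton] at hx
    rcases hx with rfl | rfl <;> rw [hmem]
  have hP₂row : P₂ ⊆ row 2 := by
    intro x hx
    simp only [hP₂, Finset.mem_singleton] at hx
    rw [hx, hmem]
  have hP₀card : P₀.card = 4 := by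
    simp [hP₀, hf, n01.symm, n02.symm, n03.symm, n12.symm, n13.symm, n23.symm]
  have hP₁card : P₁.card = 2 := by
    simp [hP₁, hf, n01]
  obtain ⟨x, hx, hx'⟩ := hk (row 0) P₀ (hrowcard 0) hP₀row hP₀card
  obtain ⟨y, hy, hy'⟩ := Shuffles.of_subset hP₁row
  obtain ⟨z, hz, hz'⟩ := Shuffles.of_subset hP₂row
  obtain ⟨σ, hσ, hσ'⟩ := Shuffles.of_subset (subset_refl P₀)
  rw [Finset.sdiff_self, symmetrizer_empty, mul_one] at hσ'
  rw [hP₁card, hrowcard] at hy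
  rw [hP₂, Finset.card_singleton, hrowcard, one_mul] at hz
  rw [hP₀card] at hσ
  set prep : PermAlgebra α := lazySwap (f i₃ 0) (f i₀ 2) p *
    (lazySwap (f i₂ 0) (f i₁ 1) s * lazySwap (f i₁ 0) (f i₀ 1) t) with hprep
  have hprepB : BlockProduct Ω 6 prep :=
    (StarProduct.blockProduct (hfΩ _ _) (.lazySwap (hfΩ _ _) hp0 hp1)).mul_mul
      ((StarProduct.blockProduct (hfΩ _ _) (.lazySwap (hfΩ _ _) hs0 hs1)).mul_mul
        (StarProduct.blockProduct (hfΩ _ _) (.lazySwap (hfΩ _ _) ht0 ht1)))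
  have hcolΩ : ∀ i, ({f i 0, f i 1, f i 2} : Finset α) ⊆ Ω := by
    intro i x hx
    simp only [Finset.mem_insert, Finset.mem_singleton] at hx
    rcases hx with rfl | rfl | rfl <;> exact hfΩ _ _
  set D : PermAlgebra α :=
    ((List.finRange m).map fun i => symmetrizer {f i 0, f i 1, f i 2}).prod with hD
  have hDB : BlockProduct Ω (m * 4) D := by
    have := BlockProduct.list_prod (A := Ω) (k := 4)
      (y := fun i => symmetrizer ({f i 0, f i 1, f i 2} : Finset α)) (fun i => ?_)
      (List.finRange m)
    · rwa [List.length_finRange] at this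
    · refine StarProduct.blockProduct (hfΩ i 0) ((starProduct_symmetrizer_triple ?_ ?_ ?_).mono
        (hcolΩ i) le_rfl) <;> simp [hf]
  -- Four units for each column, `k + 2 m + m` for the rows, and two for each of the three
  -- preparatory blocks.
  have hB : BlockProduct Ω (m * 4 + (k + (2 * m + m)) + 6) (D * (x * (y * z)) * prep) :=
    (hDB.mul_mul ((hx.mono (hrowΩ 0) le_rfl).mul_mul ((hy.mono (hrowΩ 1) le_rfl).mul_mul
      (hz.mono (hrowΩ 2) le_rfl)))).mul_mul hprepB
  have hprepact : setAction prep (pointWeight P₀) =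
      (1 - p) • ((1 - s) • ((1 - t) • pointWeight (S (f i₃ 0) (f i₂ 0) (f i₁ 0))
            + t • pointWeight (S (f i₃ 0) (f i₂ 0) (f i₀ 1)))
          + s • ((1 - t) • pointWeight (S (f i₃ 0) (f i₁ 1) (f i₁ 0))
            + t • pointWeight (S (f i₃ 0) (f i₁ 1) (f i₀ 1))))
        + p • ((1 - s) • ((1 - t) • pointWeight (S (f i₀ 2) (f i₂ 0) (f i₁ 0))
            + t • pointWeight (S (f i₀ 2) (f i₂ 0) (f i₀ 1)))
          + s • ((1 - t) • pointWeight (S (f i₀ 2) (f i₁ 1) (f i₁ 0))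
            + t • pointWeight (S (f i₀ 2) (f i₁ 1) (f i₀ 1)))) := by
    have hSv : ∀ u v w, S u v w = Insert.insert v {u, w, f i₀ 0} := fun u v w => Finset.insert_comm _ _ _
    have hSw : ∀ u v w, S u v w = Insert.insert w {u, v, f i₀ 0} := fun u v w => by
      rw [hS, Finset.insert_comm v, Finset.insert_comm u]
    have hw : setAction (lazySwap (f i₁ 0) (f i₀ 1) t)
        (pointWeight (S (f i₃ 0) (f i₂ 0) (f i₁ 0)))
        = (1 - t) • pointWeight (S (f i₃ 0) (f i₂ 0) (f i₁ 0))
          + t • pointWeight (S (f i₃ 0) (f i₂ 0) (f i₀ 1)) := by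
      rw [hSw, hSw]
      exact setAction_lazySwap_pointWeight (by simp [hf, n13, n12, n01.symm]) (by simp [hf]) t
    have hv : ∀ w, w = f i₁ 0 ∨ w = f i₀ 1 → setAction (lazySwap (f i₂ 0) (f i₁ 1) s)
        (pointWeight (S (f i₃ 0) (f i₂ 0) w))
        = (1 - s) • pointWeight (S (f i₃ 0) (f i₂ 0) w)
          + s • pointWeight (S (f i₃ 0) (f i₁ 1) w) := by
      intro w hw
      rw [hSv, hSv]
      refine setAction_lazySwap_pointWeight ?_ ?_ s <;>
        rcases hw with rfl | rfl <;> simp [hf, n23, n12.symm, n02.symm, n01.symm]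
    have hu : ∀ v w, v = f i₂ 0 ∨ v = f i₁ 1 → w = f i₁ 0 ∨ w = f i₀ 1 →
        setAction (lazySwap (f i₃ 0) (f i₀ 2) p) (pointWeight (S (f i₃ 0) v w))
        = (1 - p) • pointWeight (S (f i₃ 0) v w) + p • pointWeight (S (f i₀ 2) v w) := by
      intro v w hv hw
      refine setAction_lazySwap_pointWeight ?_ ?_ p <;>
        rcases hv with rfl | rfl <;> rcases hw with rfl | rfl <;>
        simp [hf, n23.symm, n13.symm, n03.symm]
    have hSP : pointWeight P₀ = pointWeight (S (f i₃ 0) (f i₂ 0) (f i₁ 0)) := rfl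
    rw [hSP, hprep, setAction_mul, setAction_mul, hw]
    simp only [map_add, map_smul]
    rw [hv _ (.inl rfl), hv _ (.inr rfl)]
    simp only [map_add, map_smul]
    rw [hu _ _ (.inl rfl) (.inl rfl), hu _ _ (.inl rfl) (.inr rfl), hu _ _ (.inr rfl) (.inl rfl),
      hu _ _ (.inr rfl) (.inr rfl)]
    module
  have hlaw : ∀ u v w, u = f i₃ 0 ∨ u = f i₀ 2 → v = f i₂ 0 ∨ v = f i₁ 1 →
      w = f i₁ 0 ∨ w = f i₀ 1 → ∀ i j l, ((S u v w) ∩ row 0).card = i →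
      ((S u v w) ∩ row 1).card = j → ((S u v w) ∩ row 2).card = l → ∀ T ⊆ Ω,
      setAction (x * (y * z)) (pointWeight (S u v w)) T =
        if (T ∩ row 0).card = i ∧ (T ∩ row 1).card = j ∧ (T ∩ row 2).card = l then
          ((m.choose i : ℕ) : ℝ)⁻¹ * (((m.choose j : ℕ) : ℝ)⁻¹ * ((m.choose l : ℕ) : ℝ)⁻¹)
        else 0 := by
    intro u v w hu hv hw i j l hi hj hl T hT
    -- Every outcome of `prep` lies on starting positions of the three row shuffles. Some of these
    -- may be vacant, which does no harm: a shuffle also serves fewer counters than it is made for.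
    have hSsub : S u v w ⊆ P₀ ∪ (P₁ ∪ P₂) := by
      rcases hu with rfl | rfl <;> rcases hv with rfl | rfl <;> rcases hw with rfl | rfl <;>
        simp [hS, hP₀, hP₁, hP₂, Finset.insert_subset_iff]
    have hSΩ : S u v w ⊆ row 0 ∪ (row 1 ∪ row 2) :=
      hSsub.trans (Finset.union_subset_union hP₀row (Finset.union_subset_union hP₁row hP₂row))
    have hd : ∀ q, q ∉ S u v w ∨ q ∈ P₀ ∨ q ∈ P₁ ∨ q ∈ P₂ := by
      intro q
      by_cases hq : q ∈ S u v w
      · have := hSsub hq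
        rw [Finset.mem_union, Finset.mem_union] at this
        exact .inr this
      · exact .inl hq
    rw [setAction_three_shuffles h01 h02 h12 Finset.sdiff_subset Finset.sdiff_subset
      hy.mem_lazyProducts hz.mem_lazyProducts hx' hy' hz', setAction_symmetrizer_three h01 h02 h12
      hSΩ (hΩrow ▸ hT), hi, hj, hl, hrowcard, hrowcard, hrowcard]
    all_goals
      rw [Finset.disjoint_left]
      intro q hq
      obtain ⟨hq1, hq2⟩ := Finset.mem_sdiff.1 hq
      rcases hd q with h | h | h | h
      · exact h
    · exact absurd h hq2
    · exact absurd (hP₁row h) (Finset.disjoint_left.1 h01 hq1)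
    · exact absurd (hP₂row h) (Finset.disjoint_left.1 h02 hq1)
    · exact absurd (hP₀row h) (Finset.disjoint_right.1 h01 hq1)
    · exact absurd h hq2
    · exact absurd (hP₂row h) (Finset.disjoint_left.1 h12 hq1)
    · exact absurd (hP₀row h) (Finset.disjoint_right.1 h02 hq1)
    · exact absurd (hP₁row h) (Finset.disjoint_right.1 h12 hq1)
    · exact absurd h hq2
  have hbefore : ∀ T ⊆ Ω, setAction (x * (y * z)) (setAction prep (pointWeight P₀)) T
      = rowCountLaw m p s t (T ∩ row 0).card (T ∩ row 1).card (T ∩ row 2).card := by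
    intro T hT
    rw [hprepact]
    simp only [map_add, map_smul, Pi.add_apply, Pi.smul_apply, smul_eq_mul]
    rw [hlaw _ _ _ (.inl rfl) (.inl rfl) (.inl rfl) 4 0 0 ?_ ?_ ?_ T hT,
      hlaw _ _ _ (.inl rfl) (.inl rfl) (.inr rfl) 3 1 0 ?_ ?_ ?_ T hT,
      hlaw _ _ _ (.inl rfl) (.inr rfl) (.inl rfl) 3 1 0 ?_ ?_ ?_ T hT,
      hlaw _ _ _ (.inl rfl) (.inr rfl) (.inr rfl) 2 2 0 ?_ ?_ ?_ T hT,
      hlaw _ _ _ (.inr rfl) (.inl rfl) (.inl rfl) 3 0 1 ?_ ?_ ?_ T hT,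
      hlaw _ _ _ (.inr rfl) (.inl rfl) (.inr rfl) 2 1 1 ?_ ?_ ?_ T hT,
      hlaw _ _ _ (.inr rfl) (.inr rfl) (.inl rfl) 2 1 1 ?_ ?_ ?_ T hT,
      hlaw _ _ _ (.inr rfl) (.inr rfl) (.inr rfl) 1 2 1 ?_ ?_ ?_ T hT]
    · rfl
    all_goals
      simp [hS, hf, hmem, Finset.insert_inter_of_mem, Finset.insert_inter_of_notMem,
        n01.symm, n02.symm, n03.symm, n12.symm, n13.symm, n23.symm]
  have hunif : ∀ T ⊆ Ω, T.card = P₀.card →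
      setAction (D * (x * (y * z)) * prep) (pointWeight P₀) T = κ := by
    intro T hT hTcard
    rw [hP₀card] at hTcard
    have hcover : (Finset.univ.biUnion fun i => ({f i 0, f i 1, f i 2} : Finset α)) = Ω := by
      ext q
      simp only [Finset.mem_biUnion, Finset.mem_univ, true_and]
      constructor
      · rintro ⟨i, hi⟩
        exact hcolΩ i hi
      · intro hq
        obtain ⟨i, r, rfl⟩ := hΩf q hq
        refine ⟨i, ?_⟩
        fin_cases r <;> simp
    have hcoldisj : ∀ i j, i ≠ j →
        Disjoint ({f i 0, f i 1, f i 2} : Finset α) {f j 0, f j 1, f j 2} := by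
      intro i j hij
      simp [hf, hij.symm]
    have htoFinset : (List.finRange m).toFinset = Finset.univ := by ext; simp
    rw [setAction_mul, setAction_mul, setAction_prod_symmetrizer_columns
      (A := row 0) (B := row 1) (C := row 2) (fun i => by simp [hmem]) (fun i => by simp [hmem])
      (fun i => by simp [hmem]) hcoldisj hcolΩ hbefore (List.nodup_finRange m) hT, htoFinset,
      hcover, Finset.sdiff_eq_empty_iff_subset.2 hT]
    simp only [Finset.empty_inter, Finset.card_empty]
    refine foldr_columnAverage_rowCountLaw hκ1 hκ2 hκ3 hκ4 ?_ ?_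
    · intro h hh
      obtain ⟨i, _, rfl⟩ := List.mem_map.1 hh
      exact (Finset.card_le_card Finset.inter_subset_right).trans Finset.card_le_three
    · rw [← Fin.sum_univ_def, ← Finset.card_biUnion, ← Finset.inter_biUnion, hcover,
        Finset.inter_eq_left.2 hT, hTcard]
      exact fun i _ j _ hij => (hcoldisj i j hij).mono Finset.inter_subset_right
        Finset.inter_subset_right
  have hP₀Ω : P₀ ⊆ Ω := hP₀row.trans (hrowΩ 0)
  -- The constant is 6 for `prep` plus 16 for `σ`, which acts first and puts the four counters in
  -- random order.
  have hshuf : Shuffles Ω P₀ (k + 7 * m + 22) := by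
    refine ⟨D * (x * (y * z)) * prep * σ, ?_, ?_⟩
    · exact (hB.mul_mul (hσ.mono hP₀Ω le_rfl)).mono subset_rfl (by omega)
    · rw [hσ']
      exact mul_symmetrizer_eq_of_uniform hP₀Ω hB.mem_lazyProducts hunif
  exact hshuf.of_card_eq hP₀Ω hP (hP4.trans hP₀card.symm)

end Tripling

/-! ### Solving the recursion and grouping the counters. -/

section Counting

variable {α : Type*} [Fintype α] [DecidableEq α]

/-- The constant 18 is `4 * 4 + 2` from `Shuffles.insert`. -/
theorem shuffles_succ {n k : ℕ} (hn : 4 ≤ n)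
    (h : ∀ A P : Finset α, A.card = n → P ⊆ A → P.card = 4 → Shuffles A P k) (A P : Finset α)
    (hA : A.card = n + 1) (hP : P ⊆ A) (hP4 : P.card = 4) : Shuffles A P (k + 18) := by
  obtain ⟨b, hb⟩ : (A \ P).Nonempty := by
    rw [← Finset.card_pos, Finset.card_sdiff_of_subset hP]
    omega
  obtain ⟨hbA, hbP⟩ := Finset.mem_sdiff.1 hb
  have hPA : P ⊆ A.erase b := Finset.subset_erase.2 ⟨hP, hbP⟩
  have := (h (A.erase b) P (by rw [Finset.card_erase_of_mem hbA, hA]; rfl) hPA hP4).insert hPA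
    (Finset.card_pos.1 (by omega)) (Finset.notMem_erase b A)
  rwa [Finset.insert_erase hbA, hP4] at this

theorem one_le_log_of_three_le {n : ℕ} (hn : 3 ≤ n) : 1 ≤ Real.log n := by
  rw [Real.le_log_iff_exp_le (by positivity)]
  have h1 : (3 : ℝ) ≤ n := by exact_mod_cast hn
  linarith [Real.exp_one_lt_d9]

/-- Four counters are shuffled among `n` positions by `7 n / 2 + O(log n)` transpositions. -/
theorem exists_shuffles_four (α : Type*) [Fintype α] [DecidableEq α] (n : ℕ) (hn : 4 ≤ n) :
    ∃ k : ℕ, (k : ℝ) ≤ 7 / 2 * n + 60 * Real.log n ∧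
      ∀ A P : Finset α, A.card = n → P ⊆ A → P.card = 4 → Shuffles A P k := by
  induction n using Nat.strong_induction_on with
  | _ n ih =>
    -- From 56 on, a third of `n` is at least 18, as tripling requires. Below, `4 n` exceeds `7 n /
    -- 2` by at most 28, which the logarithm covers.
    rcases Nat.lt_or_ge n 56 with hlt | hge
    · refine ⟨4 * n, ?_, fun A P hA hP hP4 => ?_⟩
      · have h1 := one_le_log_of_three_le (n := n) (by omega)
        have h2 : (n : ℝ) ≤ 56 := by exact_mod_cast hlt.le
        push_cast
        linarith
      · have := Shuffles.of_subset hP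
        rwa [hA, hP4] at this
    · obtain ⟨m, s, hs, hns, hm⟩ : ∃ m s : ℕ, s < 3 ∧ n = 3 * m + s ∧ 18 ≤ m :=
        ⟨n / 3, n % 3, by omega, by omega, by omega⟩
      obtain ⟨k, hk, hshuf⟩ := ih m (by omega) (by omega)
      have h0 : ∀ A P : Finset α, A.card = 3 * m → P ⊆ A → P.card = 4 →
          Shuffles A P (k + 7 * m + 23) :=
        fun A P hA hP hP4 => Shuffles.triple hm hA hshuf hP hP4
      have h1 := shuffles_succ (by omega) h0
      have h2 := shuffles_succ (by omega) h1
      -- Each tripling adds at most `23 + 18 + 18 = 59` beyond `7 m`; since `log 3 ≥ 1`, the term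
      -- `60 log n` grows by at least 60.
      refine ⟨k + 7 * m + 23 + 18 + 18, ?_, ?_⟩
      · have hm0 : (0 : ℝ) < m := by exact_mod_cast (by omega : 0 < m)
        have h3m : (3 : ℝ) * m ≤ n := by exact_mod_cast (by omega : 3 * m ≤ n)
        have hlog : Real.log m + 1 ≤ Real.log n := by
          have h3 : Real.log (3 * m) ≤ Real.log n := Real.log_le_log (by positivity) h3m
          rw [Real.log_mul (by norm_num) hm0.ne'] at h3
          have := one_le_log_of_three_le (n := 3) le_rfl
          push_cast at this
          linarith
        push_cast
        linarith
      · intro A P hA hP hP4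
        rcases s with _ | _ | _ | s
        · exact (h0 A P (by omega) hP hP4).mono (by omega)
        · exact (h1 A P (by omega) hP hP4).mono (by omega)
        · exact h2 A P (by omega) hP hP4
        · omega

/-- The counters are shuffled in groups of four. -/
theorem exists_shuffles_of_card_eq (l r : ℕ) (A P : Finset α) (hP : P ⊆ A)
    (hcard : P.card = 4 * l + r) : ∃ k : ℕ,
      (k : ℝ) ≤ 7 / 2 * (l * A.card - 2 * l * (l - 1)) + 60 * l * Real.log A.card
        + r * (A.card - 4 * l) ∧ Shuffles A P k := by
  induction l generalizing A P with
  | zero =>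
    refine ⟨_, ?_, Shuffles.of_subset hP⟩
    rw [hcard]
    push_cast
    linarith
  | succ l ih =>
    obtain ⟨Q, hQP, hQ⟩ := Finset.exists_subset_card_eq (show 4 ≤ P.card by omega)
    have hQA := hQP.trans hP
    have hle : 4 ≤ A.card := by rw [← hQ]; exact Finset.card_le_card hQA
    obtain ⟨k₁, hk₁, h₁⟩ := exists_shuffles_four α A.card hle
    obtain ⟨k₂, hk₂, h₂⟩ := ih (A \ Q) (P \ Q) (Finset.sdiff_subset_sdiff hP subset_rfl)
      (by rw [Finset.card_sdiff_of_subset hQP, hQ]; omega)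
    -- Each group leaves four fewer positions for the next: the numbers `A.card - 4 j` for `j < l`
    -- add up to `l * A.card - 2 * l * (l - 1)`.
    refine ⟨k₁ + k₂, ?_, ?_⟩
    · have hc : ((A \ Q).card : ℝ) = A.card - 4 := by
        rw [Finset.card_sdiff_of_subset hQA, hQ, Nat.cast_sub hle]
        norm_num
      have hlog : Real.log (A \ Q).card ≤ Real.log A.card := by
        rcases Nat.eq_zero_or_pos (A \ Q).card with h0 | h0
        · rw [h0, Nat.cast_zero, Real.log_zero]
          exact Real.log_natCast_nonneg _
        · exact Real.log_le_log (by exact_mod_cast h0)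
            (by exact_mod_cast Finset.card_le_card Finset.sdiff_subset)
      have hlog' : 60 * (l : ℝ) * Real.log (A \ Q).card ≤ 60 * (l : ℝ) * Real.log A.card :=
        mul_le_mul_of_nonneg_left hlog (by positivity)
      rw [hc] at hk₂ hlog'
      push_cast
      linarith
    · have := (h₁ A Q rfl hQA hQ).union h₂
      rwa [Finset.union_sdiff_of_subset hQP] at this

end Counting

/-! ### From the group algebra back to random permutations and counters. -/

section Laws

/-- The expected value of a function on a finite type. -/
noncomputable def PMF.expectation {β V : Type*} [Fintype β] [AddCommGroup V] [Module ℝ V]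
    (μ : PMF β) (F : β → V) : V := ∑ b, (μ b).toReal • F b

section Expectation

variable {β γ V : Type*} [Fintype β] [Fintype γ] [AddCommGroup V] [Module ℝ V]

theorem PMF.expectation_bind (μ : PMF β) (κ : β → PMF γ) (F : γ → V) :
    (μ.bind κ).expectation F = μ.expectation fun b => (κ b).expectation F := by
  simp only [PMF.expectation, Finset.smul_sum, smul_smul]
  rw [Finset.sum_comm]
  refine Finset.sum_congr rfl fun c _ => ?_
  rw [PMF.bind_apply, tsum_fintype, ENNReal.toReal_sum, Finset.sum_smul]
  · simp only [ENNReal.toReal_mul]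
  · exact fun b _ => ENNReal.mul_ne_top (μ.apply_ne_top b) ((κ b).apply_ne_top c)

theorem PMF.expectation_pure [DecidableEq β] (b : β) (F : β → V) :
    (PMF.pure b).expectation F = F b := by
  rw [PMF.expectation, Finset.sum_eq_single b]
  · simp
  · intro c _ hc
    simp [PMF.pure_apply, hc]
  · simp

theorem PMF.expectation_map [DecidableEq γ] (μ : PMF β) (g : β → γ) (F : γ → V) :
    (μ.map g).expectation F = μ.expectation fun b => F (g b) := by
  rw [PMF.map, PMF.expectation_bind]
  simp only [Function.comp_apply, PMF.expectation_pure]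

end Expectation

/-- A sequence of lazy transpositions as an element of the group algebra. -/
noncomputable def algebraProduct {n : ℕ} : List (LazyTransposition n) → PermAlgebra (Fin n)
  | [] => 1
  | T :: L => algebraProduct L * lazySwap T.a T.b T.p

theorem algebraProduct_append {n : ℕ} (L : List (LazyTransposition n)) (T : LazyTransposition n) :
    algebraProduct (L ++ [T]) = lazySwap T.a T.b T.p * algebraProduct L := by
  induction L with
  | nil => simp [algebraProduct]
  | cons S L ih => rw [List.cons_append, algebraProduct, ih, algebraProduct, mul_assoc]

theorem LazyTransposition.expectation_law {n : ℕ} (T : LazyTransposition n) :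
    T.law.expectation permOf = lazySwap T.a T.b T.p := by
  rw [LazyTransposition.law, PMF.expectation_map, PMF.expectation, Fintype.sum_bool, lazySwap,
    add_comm]
  have h1 : (T.firingLaw true).toReal = T.p := by
    simp [LazyTransposition.firingLaw]
  have h2 : (T.firingLaw false).toReal = 1 - T.p := by
    have hp : (T.p : ENNReal) ≤ 1 := by exact_mod_cast T.p_le_one
    simp [LazyTransposition.firingLaw, ENNReal.toReal_sub_of_le hp]
  rw [h1, h2]
  have h3 : permOf (1 : Equiv.Perm (Fin n)) = 1 := map_one _
  simp [h3]

/-- By independence, expectation in the group algebra turns composition of random permutations into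
multiplication. -/
theorem expectation_compositionLaw {n : ℕ} (L : List (LazyTransposition n)) :
    (compositionLaw L).expectation permOf = algebraProduct L := by
  induction L with
  | nil =>
    rw [compositionLaw, PMF.expectation_pure, algebraProduct]
    exact map_one _
  | cons T L ih =>
    rw [compositionLaw, PMF.expectation_bind, algebraProduct, ← ih, ← T.expectation_law]
    simp only [PMF.expectation_map]
    simp only [PMF.expectation, permOf, map_mul, Finset.sum_mul, Finset.mul_sum, smul_mul_assoc,
      mul_smul_comm, Finset.smul_sum]

theorem StarProduct.exists_list {n : ℕ} {A : Finset (Fin n)} {o : Fin n} (ho : (o : ℕ) = 0) {k : ℕ}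
    {x : PermAlgebra (Fin n)} (hx : StarProduct A o k x) :
    ∃ L : List (LazyTransposition n), (∀ T ∈ L, T.IsStar) ∧ L.length ≤ k ∧
      algebraProduct L = x := by
  induction hx with
  | one k => exact ⟨[], by simp, by simp, rfl⟩
  | @mul k b p x hb h0 h1 _ ih =>
    obtain ⟨L, hL, hlen, rfl⟩ := ih
    -- A star product may pair the centre with itself; that factor is the identity and is dropped,
    -- so the length is only bounded by `k`.
    by_cases hob : o = b
    · refine ⟨L, hL, by omega, ?_⟩
      have h3 : permOf (Equiv.refl (Fin n)) = 1 := map_one (MonoidAlgebra.of ℝ _)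
      rw [hob, _root_.lazySwap, Equiv.swap_self, h3, ← add_smul, sub_add_cancel, one_smul, one_mul]
    · let T : LazyTransposition n := ⟨o, b, hob, ⟨p, h0⟩, h1⟩
      refine ⟨L ++ [T], ?_, by simpa using hlen, algebraProduct_append L T⟩
      intro S hS
      rcases List.mem_append.1 hS with h | h
      · exact hL S h
      · rw [List.mem_singleton.1 h]
        exact ho

/-- A sequence of lazy transpositions that becomes uniform after averaging over the permutations
that fix the counters is a shuffle. -/
theorem isShuffle_of_mul_symmetrizer {t n : ℕ} (htn : t ≤ n) {L : List (LazyTransposition n)}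
    (hL : algebraProduct L * symmetrizer (Finset.univ \ Finset.univ.filter fun i : Fin n => i.1 < t)
      = symmetrizer Finset.univ) : IsShuffle t L := by
  classical
  refine ⟨htn, ?_⟩
  set ρ := Representation.ofMulAction ℝ (Equiv.Perm (Fin n)) (Fin t ↪ Fin n) with hρ
  set e₀ : Fin t ↪ Fin n := Fin.castLEEmb htn with he₀
  set ν := (compositionLaw L).map (counterPositions htn) with hν
  set V := ρ.asAlgebraHom (symmetrizer Finset.univ) (MonoidAlgebra.single e₀ 1) with hV
  have hof : ∀ g v, ρ.asAlgebraHom (permOf g) v = ρ g v := fun g v => by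
    rw [permOf, Representation.asAlgebraHom_of]
  have hsmul : ∀ σ : Equiv.Perm (Fin n), σ • e₀ = counterPositions htn σ := fun σ => by
    ext i; rfl
  -- Permutations that avoid the counters fix `e₀`, so by `hL` the law of the placement is the full
  -- symmetrizer applied to `e₀`. It is invariant, hence constant, because permutations act
  -- transitively on injections.
  have hfix : ρ.asAlgebraHom
      (symmetrizer (Finset.univ \ Finset.univ.filter fun i : Fin n => i.1 < t))
      (MonoidAlgebra.single e₀ 1) = MonoidAlgebra.single e₀ 1 := by
    rw [symmetrizer, map_smul, map_sum, LinearMap.smul_apply, LinearMap.sum_apply]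
    have hterm : ∀ g : permsOn (Finset.univ \ Finset.univ.filter fun i : Fin n => i.1 < t),
        ρ.asAlgebraHom (permOf g.1) (MonoidAlgebra.single e₀ (1 : ℝ)) = MonoidAlgebra.single e₀ 1 := by
      intro g
      rw [hof, hρ, Representation.ofMulAction_single]
      congr 1
      ext i
      have : g.1 (e₀ i) = e₀ i := g.2 _ (by simp [he₀])
      exact congrArg Fin.val this
    rw [Finset.sum_congr rfl fun g _ => hterm g, Finset.sum_const, Finset.card_univ,
      ← Nat.cast_smul_eq_nsmul ℝ, smul_smul, inv_mul_cancel₀ (card_permsOn_ne_zero _), one_smul]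
  have hlaw : ν.expectation (fun e => MonoidAlgebra.single e (1 : ℝ)) = V := by
    rw [hV, ← hL, map_mul, Module.End.mul_apply, hfix, ← expectation_compositionLaw, hν,
      PMF.expectation_map, PMF.expectation, PMF.expectation, map_sum, LinearMap.sum_apply]
    refine Finset.sum_congr rfl fun σ _ => ?_
    rw [map_smul, LinearMap.smul_apply, hof, hρ, Representation.ofMulAction_single, hsmul]
  have hνV : ∀ e, (ν e).toReal = V.coeff e := by
    intro e
    rw [← hlaw, PMF.expectation, MonoidAlgebra.coeff_sum, Finsupp.finsetSum_apply, Finset.sum_eq_single e]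
    · simp
    · intro e' _ he'
      simp [he']
    · simp
  have hinv : ∀ (g : Equiv.Perm (Fin n)) (e : Fin t ↪ Fin n), V.coeff (g • e) = V.coeff e := by
    intro g e
    have h1 : ρ g V = V := by
      rw [← hof, hV, ← Module.End.mul_apply, ← map_mul, permOf_mul_symmetrizer]
      exact fun x hx => absurd (Finset.mem_univ x) hx
    conv_lhs => rw [← h1]
    rw [hρ, Representation.coeff_ofMulAction, inv_smul_smul]
  have hconst : ∀ e e', ν e = ν e' := by
    intro e e'
    rw [← ENNReal.toReal_eq_toReal_iff' (ν.apply_ne_top e) (ν.apply_ne_top e'), hνV, hνV]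
    have := Equiv.Perm.isMultiplyPretransitive (Fin n) t
    obtain ⟨g, rfl⟩ := MulAction.exists_smul_eq (Equiv.Perm (Fin n)) e e'
    exact (hinv g e).symm
  intro e
  have hsum : ∑ e', ν e' = 1 := (tsum_fintype _).symm.trans ν.tsum_coe
  rw [Finset.sum_congr rfl fun e' _ => hconst e' e, Finset.sum_const, Finset.card_univ,
    Fintype.card_embedding_eq, Fintype.card_fin, Fintype.card_fin,
    Nat.descFactorial_eq_factorial_mul_choose, nsmul_eq_mul, mul_comm] at hsum
  exact ENNReal.eq_inv_of_mul_eq_one_left hsum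

/-- Four counters at a time give short star shuffles. -/
theorem exists_mem_starShuffleLengths {l r n : ℕ} (hn : 1 ≤ n) (htn : 4 * l + r ≤ n) :
    ∃ k ∈ starShuffleLengths (4 * l + r) n,
      (k : ℝ) ≤ 7 / 2 * (l * n - 2 * l * (l - 1)) + 60 * l * Real.log n + r * (n - 4 * l) := by
  set P : Finset (Fin n) := Finset.univ.filter fun i => i.1 < 4 * l + r with hP
  have hPcard : P.card = 4 * l + r := by
    rw [hP, Fin.card_filter_val_lt, min_eq_right htn]
  obtain ⟨k, hk, hshuf⟩ := exists_shuffles_of_card_eq l r Finset.univ P (Finset.subset_univ _) hPcard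
  obtain ⟨x, hx, hx'⟩ := hshuf.exists_starProduct (Finset.subset_univ _) (Finset.subset_univ P) rfl
    (o := ⟨0, hn⟩) (Finset.mem_univ _)
  obtain ⟨L, hL, hlen, rfl⟩ := hx.exists_list rfl
  rw [Finset.card_univ, Fintype.card_fin] at hk
  exact ⟨L.length, ⟨L, hL, isShuffle_of_mul_symmetrizer htn hx', rfl⟩,
    le_trans (by exact_mod_cast hlen) hk⟩

theorem isLeast_starU {t n k : ℕ} (hk : k ∈ starShuffleLengths t n) :
    IsLeast (starShuffleLengths t n) (starU t n) ∧ starU t n ≤ k :=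
  ⟨⟨Nat.sInf_mem ⟨k, hk⟩, fun _ h => Nat.sInf_le h⟩, Nat.sInf_le hk⟩

end Laws

/-! ### The two bounds. -/

theorem theorem3 :
    (∀ l : ℕ, ∃ C : ℝ, ∀ r t n : ℕ, r < 4 → t = 4 * l + r → t ≤ n → 1 ≤ n →
      IsLeast (starShuffleLengths t n) (starU t n) ∧
      (starU t n : ℝ) ≤ (7 * (l : ℝ) / 2 + (r : ℝ)) * (n : ℝ) + C * Real.log (n : ℝ)) ∧
    (∃ C : ℝ, ∀ n : ℕ, 1 ≤ n →
      IsLeast (starShuffleLengths n n) (starU n n) ∧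
      (starU n n : ℝ) ≤ 7 / 8 * (n.choose 2 : ℝ) + C * ((n : ℝ) * Real.log (n : ℝ))) := by
  refine ⟨fun l => ⟨60 * l, ?_⟩, ⟨100, ?_⟩⟩
  · rintro r t n _ rfl htn hn
    obtain ⟨k, hk, hbound⟩ := exists_mem_starShuffleLengths hn htn
    obtain ⟨hleast, hle⟩ := isLeast_starU hk
    refine ⟨hleast, ?_⟩
    have h1 : (starU (4 * l + r) n : ℝ) ≤ k := by exact_mod_cast hle
    have h2 : (0 : ℝ) ≤ l * (l - 1) := by
      rcases Nat.eq_zero_or_pos l with rfl | h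
      · simp
      · have : (1 : ℝ) ≤ l := by exact_mod_cast h
        exact mul_nonneg (by positivity) (by linarith)
    have h3 : (0 : ℝ) ≤ r * (4 * l) := by positivity
    linarith
  · intro n hn
    obtain ⟨l, r, hr, hnl⟩ : ∃ l r : ℕ, r < 4 ∧ n = 4 * l + r :=
      ⟨n / 4, n % 4, by omega, by omega⟩
    obtain ⟨k, hk, hbound⟩ := exists_mem_starShuffleLengths (l := l) (r := r) hn hnl.ge
    rw [← hnl] at hk
    obtain ⟨hleast, hle⟩ := isLeast_starU hk
    refine ⟨hleast, ?_⟩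
    -- For `n ≥ 2` the linear terms are absorbed since `log n ≥ 1 / 2`. For `n = 1` the right side
    -- is zero, and indeed no transposition exists.
    rcases Nat.lt_or_ge 1 n with h1n | hn1
    · have h1 : (starU n n : ℝ) ≤ k := by exact_mod_cast hle
      have hlog : 1 / 2 ≤ Real.log n := by
        have h2 : Real.log 2 ≤ Real.log n :=
          Real.log_le_log (by norm_num) (by exact_mod_cast h1n)
        linarith [Real.log_two_gt_d9]
      have hnr : (n : ℝ) = 4 * l + r := by exact_mod_cast hnl
      have hr0 : (0 : ℝ) ≤ r := by positivity
      have hr3 : (r : ℝ) ≤ 3 := by exact_mod_cast Nat.le_of_lt_succ hr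
      have hl0 : (0 : ℝ) ≤ l := by positivity
      have hn1' : (1 : ℝ) ≤ n := by exact_mod_cast hn
      rw [Nat.cast_choose_two]
      have hnlog : (n : ℝ) * (1 / 2) ≤ n * Real.log n := mul_le_mul_of_nonneg_left hlog (by linarith)
      have hllog : (l : ℝ) * Real.log n ≤ n * Real.log n / 4 := by
        have : (4 * l) * Real.log n ≤ n * Real.log n :=
          mul_le_mul_of_nonneg_right (by linarith) (by linarith)
        linarith
      -- With `l` close to `n / 4` the quadratic part is `7 / 2 * (n² / 4 - n² / 8) = 7 n² / 16`.
      have hmain : 7 / 2 * (l * n - 2 * l * (l - 1)) + r * (n - 4 * l)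
          ≤ 7 / 8 * (n * (n - 1) / 2) + 20 * (n : ℝ) := by
        rw [hnr]
        nlinarith [mul_nonneg hl0 hr0]
      linarith
    · obtain rfl : n = 1 := le_antisymm hn1 hn
      obtain ⟨⟨L, _, _, hlen⟩, _⟩ := hleast
      have hL : L = [] := List.eq_nil_iff_forall_not_mem.2 fun T _ => T.a_ne_b (Subsingleton.elim _ _)
      rw [← hlen, hL]
      simp
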